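/- Let $M$ be a smooth surface and let $T_0M$ be its tangent bundle without the zero section, with Liouville vector field $\mathcal C$ and tangent structure $J$. Let $F:TM\to\mathbb R$ be a Finsler function: $F$ is continuous, smooth and positive on $T_0M$, $F(\lambda y)=\lambda F(y)$ for $\lambda\ge 0$, and $g_{ij}=\frac12\,\partial^2F^2/\partial y^i\partial y^j$ has rank $2$ on $T_0M$. Let $S$ be its geodesic spray, i.e. the smooth vector field on $T_0M$ with $JS=\mathcal C$, $[\mathcal C,S]=S$ and $i_Sdd_JF^2=-dF^2$. Put $h=\frac12(\mathrm{Id}+[J,S])$, $v=\frac12(\mathrm{Id}-[J,S])$ (Frölicher–Nijenhuis bracket), $\Phi=v\circ[S,h]$, $\mathbb F=h\circ[S,h]-J$, $\nabla X=h[S,hX]+v[S,vX]$, and $2G(X,Y)=dd_JF^2(X,\mathbb FY)$, so that $G=g_{ij}dx^i\otimes dx^j+g_{ij}\delta y^i\otimes\delta y^j$. Assume that $S$ is non-flat: $\Phi$ vanishes at no point of $T_0M$. Then $S$ is isotropic: there are a smooth function $\rho$ (the Ricci scalar) and a smooth semi-basic $1$-form $\alpha$ on $T_0M$ with $\Phi=\rho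 J-\alpha\otimes\mathcal C$; moreover, for any such pair (it is unique), the following hold. (i) $\rho$ vanishes nowhere on $T_0M$, and $S$ is regular: the $2$-form $\Omega=d\left(\frac{\alpha}{\rho}\right)+2\,i_{\mathbb F}\frac{\alpha}{\rho}\wedge\frac{\alpha}{\rho}$ has rank $4$ at every point of $T_0M$. (ii) Let $H$ be a smooth vector field on $T_0M$ with $[\mathcal C,H]=H$, $hH=H$, $\alpha(H)=0$ and $G(H,H)=F^2$, and let $V=JH$, so that $(H,S,V,\mathcal C)$ is the Berwald frame of $F$ determined by $H$. Let $I=F\,C_{ijk}m^im^jm^k$ be the main scalar, where $C_{ijk}=\frac14\,\partial^3F^2/\partial y^i\partial y^j\partial y^k$ is the Cartan tensor and $m=\pi_*H/F$ with $\pi:TM\to M$ the projection. Then $I$ is smooth on $T_0M$, and on $T_0M$ $$H(F^2)=0,\quad V(F^2)=0,\quad \nabla H=0,\quad \nabla V=0,$$ $$[S,H]=\rho V,\quad [S,V]=-H,\quad [H,V]=S+IH+S(I)V.$$ -/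

import Mathlib

open scoped Manifold ContDiff

noncomputable section

namespace BerwaldFrame

/-- The model plane `ℝ²`. -/
abbrev Plane : Type := EuclideanSpace ℝ (Fin 2)

/-- The tangent bundle of a surface `M`. -/
abbrev TB (M : Type*) [TopologicalSpace M] [ChartedSpace Plane M] : Type _ :=
  TangentBundle 𝓘(ℝ, Plane) M

/-- The tangent vector `w ∈ T_pM` as a point of `TM`. (Mathlib identifies `T_pM` with the model
plane by the preferred chart at `p`.) -/
def toTB {M : Type*} [TopologicalSpace M] [ChartedSpace Plane M] (p : M) (w : Plane) : TB M :=
  ⟨p, w⟩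

/-- The vector `y ∈ T_pM` underlying the point `u = (p, y)` of `TM`. -/
def vec {M : Type*} [TopologicalSpace M] [ChartedSpace Plane M] (u : TB M) : Plane := u.2

/-- The tangent space of the total space `TM` at `u`. -/
abbrev TTB {M : Type*} [TopologicalSpace M] [ChartedSpace Plane M]
    [IsManifold 𝓘(ℝ, Plane) ∞ M] (u : TB M) : Type :=
  TangentSpace (𝓘(ℝ, Plane).tangent) u

section Defs

variable {M : Type*} [TopologicalSpace M] [ChartedSpace Plane M] [IsManifold 𝓘(ℝ, Plane) ∞ M]

variable (M) in
/-- The slit tangent bundle `T₀M`, as an open subset of `TM`. -/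
def slit : Set (TB M) := {u | vec u ≠ 0}

variable (M) in
/-- Vector fields on `TM`. A vector field on `T₀M` is represented by any extension to `TM`; only
its values on the open set `slit M` are ever used. -/
abbrev VField : Type _ := (u : TB M) → TTB u

variable (M) in
/-- 1-forms on `TM` (again only their values on `slit M` are used). -/
abbrev OneForm : Type _ := (u : TB M) → (TTB u →L[ℝ] ℝ)

/-- The vector field `X` is smooth at `u`. -/
def VField.SmoothAt (X : VField M) (u : TB M) : Prop :=
  ContMDiffAt (𝓘(ℝ, Plane).tangent) (𝓘(ℝ, Plane).tangent.tangent) ∞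
    (fun w : TB M => (⟨w, X w⟩ : TangentBundle (𝓘(ℝ, Plane).tangent) (TB M))) u

/-- `X` is a smooth vector field on `T₀M`. -/
def VField.Smooth (X : VField M) : Prop := ∀ u ∈ slit M, X.SmoothAt u

/-- The function `f` is smooth at `u`. -/
def FunSmoothAt (f : TB M → ℝ) (u : TB M) : Prop :=
  ContMDiffAt (𝓘(ℝ, Plane).tangent) 𝓘(ℝ, ℝ) ∞ f u

/-- `f` is a smooth function on `T₀M`. -/
def FunSmooth (f : TB M → ℝ) : Prop := ∀ u ∈ slit M, FunSmoothAt f u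

/-- The differential `df`. -/
def differential (f : TB M → ℝ) : OneForm M := fun u =>
  mfderiv (𝓘(ℝ, Plane).tangent) 𝓘(ℝ, ℝ) f u

/-- The derivative `X(f)` of a function along a vector field. -/
def dirDeriv (X : VField M) (f : TB M → ℝ) : TB M → ℝ := fun u => differential f u (X u)

/-- The Lie bracket `[X, Y]` of vector fields on `TM`. -/
def bracket (X Y : VField M) : VField M := fun u =>
  VectorField.mlieBracket (𝓘(ℝ, Plane).tangent) X Y u

/-- The vertical lift `T_pM → T_u TM` at `u ∈ T_pM`: the derivative at `u` of the inclusion of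
the fibre `T_pM` into `TM`. -/
def verticalLift (u : TB M) : Plane →L[ℝ] TTB u :=
  mfderiv 𝓘(ℝ, Plane) (𝓘(ℝ, Plane).tangent) (toTB u.1) (vec u)

/-- The differential at `u` of the bundle projection `π : TM → M`. -/
def projDeriv (u : TB M) : TTB u →L[ℝ] Plane :=
  mfderiv (𝓘(ℝ, Plane).tangent) 𝓘(ℝ, Plane) (fun w : TB M => w.1) u

variable (M) in
/-- The Liouville vector field `C = yⁱ ∂/∂yⁱ`. -/
def liouville : VField M := fun u => verticalLift u (vec u)

/-- The tangent structure `J = ∂/∂yⁱ ⊗ dxⁱ`, at a point `u`. -/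
def tangentStr (u : TB M) : TTB u →L[ℝ] TTB u := (verticalLift u).comp (projDeriv u)

/-- The tangent structure acting on vector fields. -/
def J (X : VField M) : VField M := fun u => tangentStr u (X u)

/-- A spray: a smooth vector field on `T₀M` with `J S = C` and `[C, S] = S`. -/
structure IsSpray (S : VField M) : Prop where
  smooth : S.Smooth
  second_order : ∀ u ∈ slit M, J S u = liouville M u
  homogeneous : ∀ u ∈ slit M, bracket (liouville M) S u = S u

/-- The nonlinear connection `Γ = [J, S]` (a Frölicher–Nijenhuis bracket),
`Γ X = [J X, S] - J [X, S]`. -/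
def connection (S X : VField M) : VField M := bracket (J X) S - J (bracket X S)

/-- The horizontal projector `h = (Id + Γ) / 2`. -/
def hProj (S X : VField M) : VField M := (1 / 2 : ℝ) • (X + connection S X)

/-- The vertical projector `v = (Id - Γ) / 2`. -/
def vProj (S X : VField M) : VField M := (1 / 2 : ℝ) • (X - connection S X)

/-- The Frölicher–Nijenhuis bracket `[S, h]`, i.e. the Lie derivative of `h` along `S`:
`[S, h] X = [S, h X] - h [S, X]`. -/
def lieH (S X : VField M) : VField M := bracket S (hProj S X) - hProj S (bracket S X)

/-- The almost complex structure `𝔽 = h ∘ [S, h] - J`. -/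
def almostComplex (S X : VField M) : VField M := hProj S (lieH S X) - J X

/-- The dynamical covariant derivative `∇X = h [S, h X] + v [S, v X]`. -/
def dynCov (S X : VField M) : VField M :=
  hProj S (bracket S (hProj S X)) + vProj S (bracket S (vProj S X))

/-- The Jacobi endomorphism `Φ = v ∘ [S, h]`. -/
def jacobi (S X : VField M) : VField M := vProj S (lieH S X)

/-- The spray `S` is non-flat: its Jacobi endomorphism vanishes at no point of `T₀M`. -/
def NonFlat (S : VField M) : Prop :=
  ∀ u ∈ slit M, ∃ X : VField M, X.SmoothAt u ∧ jacobi S X u ≠ 0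

/-- The pair `(ρ, α)` of a smooth function and a smooth semi-basic 1-form on `T₀M` represents the
Jacobi endomorphism of `S` as `Φ = ρ J - α ⊗ C`. On a surface there is at most one such pair on
`T₀M`; `ρ` is the Ricci scalar. -/
structure IsIsotropicPair (S : VField M) (ρ : TB M → ℝ) (α : OneForm M) : Prop where
  smooth_ρ : FunSmooth ρ
  smooth_α : ∀ u ∈ slit M, ∀ X : VField M, X.SmoothAt u → FunSmoothAt (fun w => α w (X w)) u
  semibasic : ∀ u ∈ slit M, ∀ ξ : TTB u, α u (tangentStr u ξ) = 0
  eq : ∀ u ∈ slit M, ∀ X : VField M, X.SmoothAt u →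
    jacobi S X u = ρ u • J X u - α u (X u) • liouville M u

/-- The exterior derivative of a 1-form, evaluated on vector fields:
`dβ(X, Y) = X(β(Y)) - Y(β(X)) - β([X, Y])`. -/
def extD (β : OneForm M) (X Y : VField M) : TB M → ℝ := fun u =>
  dirDeriv X (fun w => β w (Y w)) u - dirDeriv Y (fun w => β w (X w)) u - β u (bracket X Y u)

/-- The 2-form `Ω = d(α/ρ) + 2 i_𝔽(α/ρ) ∧ (α/ρ)`, evaluated on vector fields. -/
def omega (S : VField M) (ρ : TB M → ℝ) (α : OneForm M) (X Y : VField M) : TB M → ℝ :=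
  let β : OneForm M := fun w => (ρ w)⁻¹ • α w
  fun u => extD β X Y u +
    2 * (β u (almostComplex S X u) * β u (Y u) - β u (almostComplex S Y u) * β u (X u))

/-- Regularity of a spray: `Ω` has maximal rank `4`, i.e. is nondegenerate, at every point
of `T₀M`. -/
def IsRegular (S : VField M) (ρ : TB M → ℝ) (α : OneForm M) : Prop :=
  ∀ u ∈ slit M, ∀ X : VField M, X.SmoothAt u →
    (∀ Y : VField M, Y.SmoothAt u → omega S ρ α X Y u = 0) → X u = 0

/-- The restriction of `F²` to the tangent plane at `p`. -/
def fibreSq (F : TB M → ℝ) (p : M) : Plane → ℝ := fun w => F (toTB p w) ^ 2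

/-- The metric tensor `g_ij = ½ ∂²F²/∂yⁱ∂yʲ` at `u`. -/
def metricTensor (F : TB M → ℝ) (u : TB M) (a b : Plane) : ℝ :=
  (1 / 2) * iteratedFDeriv ℝ 2 (fibreSq F u.1) (vec u) ![a, b]

/-- The Cartan tensor `C_ijk = ½ ∂g_ij/∂yᵏ = ¼ ∂³F²/∂yⁱ∂yʲ∂yᵏ` at `u`. -/
def cartanTensor (F : TB M → ℝ) (u : TB M) (a b c : Plane) : ℝ :=
  (1 / 4) * iteratedFDeriv ℝ 3 (fibreSq F u.1) (vec u) ![a, b, c]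

/-- Finsler functions on a surface. -/
structure IsFinsler (F : TB M → ℝ) : Prop where
  continuous : Continuous F
  smooth : FunSmooth F
  pos : ∀ u ∈ slit M, 0 < F u
  homogeneous : ∀ (u : TB M) (c : ℝ), 0 ≤ c → F (toTB u.1 (c • vec u)) = c * F u
  nondegenerate : ∀ u ∈ slit M, ∀ a : Plane, (∀ b : Plane, metricTensor F u a b = 0) → a = 0

/-- The 1-form `d_J F² = d(F²) ∘ J`. -/
def dJSq (F : TB M → ℝ) : OneForm M := fun u =>
  (differential (fun w => F w ^ 2) u).comp (tangentStr u)

/-- The Hilbert 2-form `ω_{F²} = - d d_J F²`. -/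
def hilbertForm (F : TB M → ℝ) (X Y : VField M) : TB M → ℝ := fun u => - extD (dJSq F) X Y u

/-- `S` is the geodesic spray of `F`: `i_S d d_J F² = - dF²` on `T₀M`. -/
def IsGeodesicSpray (F : TB M → ℝ) (S : VField M) : Prop :=
  IsSpray S ∧ ∀ u ∈ slit M, ∀ X : VField M, X.SmoothAt u →
    extD (dJSq F) S X u = - dirDeriv X (fun w => F w ^ 2) u

/-- The metric `G` on `T₀M` given by `2 G(X, Y) = - ω_{F²}(X, 𝔽 Y)`, that is
`G = g_ij dxⁱ ⊗ dxʲ + g_ij δyⁱ ⊗ δyʲ`. -/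
def metricG (F : TB M → ℝ) (S X Y : VField M) : TB M → ℝ := fun u =>
  - (1 / 2) * hilbertForm F X (almostComplex S Y) u

/-- `(H, S, J H, C)` is a Berwald frame of the Finsler function `F` with geodesic spray `S`:
`[C, H] = H`, `h H = H`, `α(H) = 0` and `G(H, H) = F²`. -/
structure IsBerwald (F : TB M → ℝ) (S : VField M) (α : OneForm M) (H : VField M) : Prop where
  smooth : H.Smooth
  homogeneous : ∀ u ∈ slit M, bracket (liouville M) H u = H u
  horizontal : ∀ u ∈ slit M, hProj S H u = H u
  alpha_eq_zero : ∀ u ∈ slit M, α u (H u) = 0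
  normalised : ∀ u ∈ slit M, metricG F S H H u = F u ^ 2

/-- The main scalar of a Finsler surface with respect to `H`: with `m = π_* H / F` the unit vector
orthogonal to the direction `y`, it is the function `I` with `F C_ijk = I m_i m_j m_k`,
i.e. `I = F C(m, m, m)`. -/
def mainScalar (F : TB M → ℝ) (H : VField M) : TB M → ℝ := fun u =>
  let m : Plane := (F u)⁻¹ • projDeriv u (H u)
  F u * cartanTensor F u m m m

end Defs

end BerwaldFrame

end

open scoped Manifold ContDiff

namespace BerwaldFrame
open Filter Topology Bundle

section Calculus

set_option linter.unusedSectionVars false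

variable {M : Type*} [TopologicalSpace M] [ChartedSpace Plane M] [IsManifold 𝓘(ℝ, Plane) ∞ M]
variable {X Y Z : VField M} {f g : TB M → ℝ} {u : TB M}

/-! Everything rests on how the energy `F ^ 2` behaves under `S`, under horizontal fields and along
the fibres. The tool is the formula `[X, Y](f) = X(Y f) - Y(X f)`, applied to the energy and to
bundle coordinates `xⁱ, yⁱ`. In these coordinates `J X` kills `xⁱ` and sends `yⁱ` to `X(xⁱ)`.

Isotropy: the Euler–Lagrange equations say that horizontal vectors annihilate the energy
(`IsGeodesicSpray.dirDeriv_hProj`), hence so do the values of `Φ`. These values are also vertical.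
On a surface the vertical vectors killed by `dF²` form a line (`IsFinsler.exists_eq_smul`). Since
`Φ` kills `S` and all vertical vectors, it is determined by one number at each point: `Φ = ρ (J -
(d_J F² / 2F²) ⊗ C)` (`IsGeodesicSpray.exists_jacobi_eq`). Applying `dF²` to `Φ = ρ J - α ⊗ C` shows
that every admissible `α` is `ρ d_J F² / 2F²`, so a zero of `ρ` would be a zero of `Φ`.

Regularity: with `α / ρ = d_J F² / 2F²`, the correction term in `Ω` cancels what comes from
differentiating `1 / 2F²`. There remains `Ω = dd_J F² / 2F²` (`IsIsotropicPair.omega_eq`), which is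
nondegenerate because `dd_J F²(J X, Y) = 2 g(X, Y)` (`IsFinsler.extD_J`).

Berwald frame: the conditions on `H` become `V(F²) = 0` and `g(H, H) = F²`. The Euler–Lagrange
equations for `H` make `J[S, H]` a multiple `b V`. Those for `[H, V]`, combined with the Jacobi
identity, give `b = 0`; this is the metric compatibility `g(∇H, H) = 0`
(`IsAdapted.J_bracket_spray`). So `[S, H]` is vertical and equals `Φ H = ρ V`, while `[S, V] = -H`,
and `∇H = ∇V = 0` follows. Orthogonality gives `J[H, V] = C + I V`. Bracketing the vertical field
`[H, V] - S - I H` with `S` identifies it as `S(I) V` (`IsAdapted.bracket_eq`). Finally,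
differentiating `g(H, H) = F²` along the fibre in the direction of `H` shows that `I` is the main
scalar (`IsAdapted.mainScalar_eq`). -/

variable (M) in
/-- The topology of `TM`, as a shortcut for instance search. -/
noncomputable abbrev topologicalSpaceTB : TopologicalSpace (TB M) := inferInstance

attribute [local instance] topologicalSpaceTB

variable (M) in
/-- The topology of `TTM`, as a shortcut for instance search. -/
noncomputable abbrev topologicalSpaceTTB :
    TopologicalSpace (TangentBundle (𝓘(ℝ, Plane).tangent) (TB M)) :=
  inferInstance

attribute [local instance] topologicalSpaceTTB

instance : IsManifold (𝓘(ℝ, Plane).tangent) (minSmoothness ℝ 3) (TB M) := by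
  simp only [minSmoothness_of_isRCLikeNormedField]
  exact IsManifold.of_le (n := ∞) (WithTop.coe_le_coe.2 le_top)

instance : IsManifold (𝓘(ℝ, Plane).tangent) (minSmoothness ℝ 2) (TB M) := by
  simp only [minSmoothness_of_isRCLikeNormedField]
  exact IsManifold.of_le (n := ∞) (WithTop.coe_le_coe.2 le_top)

/-! ### Smooth and differentiable fields at a point, and rules for the Lie bracket -/

/-- The vector field `X` is differentiable at `u`. -/
def VField.DiffAt (X : VField M) (u : TB M) : Prop :=
  MDifferentiableAt (𝓘(ℝ, Plane).tangent) (𝓘(ℝ, Plane).tangent.tangent)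
    (fun w : TB M => (⟨w, X w⟩ : TangentBundle (𝓘(ℝ, Plane).tangent) (TB M))) u

/-- The function `f` is differentiable at `u`. -/
def FunDiffAt (f : TB M → ℝ) (u : TB M) : Prop :=
  MDifferentiableAt (𝓘(ℝ, Plane).tangent) 𝓘(ℝ, ℝ) f u

theorem VField.SmoothAt.diffAt (h : X.SmoothAt u) : X.DiffAt u :=
  ContMDiffAt.mdifferentiableAt h (by simp)

theorem FunSmoothAt.diffAt (h : FunSmoothAt f u) : FunDiffAt f u :=
  ContMDiffAt.mdifferentiableAt h (by simp)

theorem VField.SmoothAt.eventually_diffAt (h : X.SmoothAt u) : ∀ᶠ w in 𝓝 u, X.DiffAt w := by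
  have h1 : ContMDiffAt (𝓘(ℝ, Plane).tangent) (𝓘(ℝ, Plane).tangent.tangent) 1
    (fun w : TB M => (⟨w, X w⟩ : TangentBundle (𝓘(ℝ, Plane).tangent) (TB M))) u :=
    ContMDiffAt.of_le h (by simp)
  exact ((contMDiffAt_iff_contMDiffAt_nhds (by simp)).1 h1).mono fun w hw =>
    hw.mdifferentiableAt (by simp)

theorem FunSmoothAt.eventually_diffAt (h : FunSmoothAt f u) : ∀ᶠ w in 𝓝 u, FunDiffAt f w := by
  have h1 : ContMDiffAt (𝓘(ℝ, Plane).tangent) 𝓘(ℝ, ℝ) 1 f u := ContMDiffAt.of_le h (by simp)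
  exact ((contMDiffAt_iff_contMDiffAt_nhds (by simp)).1 h1).mono fun w hw =>
    hw.mdifferentiableAt (by simp)

theorem FunSmoothAt.congr (h : FunSmoothAt f u) (e : g =ᶠ[𝓝 u] f) : FunSmoothAt g u :=
  ContMDiffAt.congr_of_eventuallyEq h e

theorem VField.SmoothAt.add (hX : X.SmoothAt u) (hY : Y.SmoothAt u) : (X + Y).SmoothAt u :=
  ContMDiffAt.add_section hX hY

theorem VField.SmoothAt.sub (hX : X.SmoothAt u) (hY : Y.SmoothAt u) : (X - Y).SmoothAt u :=
  ContMDiffAt.sub_section hX hY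

theorem VField.SmoothAt.neg (hX : X.SmoothAt u) : (-X).SmoothAt u :=
  ContMDiffAt.neg_section hX

theorem VField.SmoothAt.const_smul (c : ℝ) (hX : X.SmoothAt u) : (c • X).SmoothAt u :=
  ContMDiffAt.const_smul_section hX

theorem VField.SmoothAt.smul (hf : FunSmoothAt f u) (hX : X.SmoothAt u) : (f • X).SmoothAt u :=
  ContMDiffAt.smul_section hf hX

theorem VField.DiffAt.add (hX : X.DiffAt u) (hY : Y.DiffAt u) : (X + Y).DiffAt u :=
  mdifferentiableAt_add_section hX hY

theorem VField.DiffAt.smul (hf : FunDiffAt f u) (hX : X.DiffAt u) : (f • X).DiffAt u :=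
  MDifferentiableAt.smul_section hf hX

theorem VField.SmoothAt.bracket (hX : X.SmoothAt u) (hY : Y.SmoothAt u) :
    (bracket X Y).SmoothAt u :=
  have : IsManifold (𝓘(ℝ, Plane).tangent) (((⊤ : ℕ∞) : WithTop ℕ∞) + 1) (TB M) :=
    inferInstanceAs (IsManifold (𝓘(ℝ, Plane).tangent) ∞ (TB M))
  ContMDiffAt.mlieBracket_vectorField (m := ⊤) (n := ⊤) hX hY (by simp)

theorem FunSmoothAt.neg (hf : FunSmoothAt f u) : FunSmoothAt (fun w => - f w) u :=
  ContMDiffAt.neg hf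

theorem FunSmoothAt.const (c : ℝ) : FunSmoothAt (fun _ : TB M => c) u := contMDiffAt_const

theorem FunSmoothAt.mul (hf : FunSmoothAt f u) (hg : FunSmoothAt g u) :
    FunSmoothAt (fun w => f w * g w) u := ContMDiffAt.mul hf hg

theorem FunSmoothAt.inv (hf : FunSmoothAt f u) (h0 : f u ≠ 0) :
    FunSmoothAt (fun w => (f w)⁻¹) u := ContMDiffAt.inv₀ hf h0

theorem FunSmoothAt.div (hf : FunSmoothAt f u) (hg : FunSmoothAt g u) (h0 : g u ≠ 0) :
    FunSmoothAt (fun w => f w / g w) u := ContMDiffAt.div₀ hf hg h0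

theorem bracket_swap : bracket X Y u = - bracket Y X u :=
  VectorField.mlieBracket_swap_apply

theorem bracket_self : bracket X X u = 0 := by
  have h : bracket X X u = - bracket X X u := bracket_swap
  have h2 : (2 : ℝ) • bracket X X u = 0 := by
    rw [two_smul]; nth_rewrite 1 [h]; simp
  exact (smul_eq_zero.1 h2).resolve_left two_ne_zero

theorem bracket_add_left (hX : X.DiffAt u) (hY : Y.DiffAt u) :
    bracket (X + Y) Z u = bracket X Z u + bracket Y Z u :=
  VectorField.mlieBracket_add_left hX hY

theorem bracket_add_right (hX : X.DiffAt u) (hY : Y.DiffAt u) :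
    bracket Z (X + Y) u = bracket Z X u + bracket Z Y u :=
  VectorField.mlieBracket_add_right hX hY

theorem bracket_const_smul_right (c : ℝ) (hX : X.DiffAt u) :
    bracket Z (c • X) u = c • bracket Z X u :=
  VectorField.mlieBracket_const_smul_right hX

theorem bracket_neg_right (hX : X.DiffAt u) : bracket Z (-X) u = - bracket Z X u := by
  have h := bracket_const_smul_right (Z := Z) (-1) hX
  simpa using h

theorem VField.DiffAt.neg (hX : X.DiffAt u) : (-X).DiffAt u :=
  mdifferentiableAt_neg_section hX

theorem bracket_sub_right (hX : X.DiffAt u) (hY : Y.DiffAt u) :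
    bracket Z (X - Y) u = bracket Z X u - bracket Z Y u := by
  rw [sub_eq_add_neg, bracket_add_right hX hY.neg, bracket_neg_right hY, sub_eq_add_neg]

theorem bracket_smul_right (hf : FunDiffAt f u) (hX : X.DiffAt u) :
    bracket Z (f • X) u = dirDeriv Z f u • X u + f u • bracket Z X u :=
  VectorField.mlieBracket_smul_right hf hX

theorem bracket_smul_left (hf : FunDiffAt f u) (hX : X.DiffAt u) :
    bracket (f • X) Z u = - dirDeriv Z f u • X u + f u • bracket X Z u :=
  VectorField.mlieBracket_smul_left hf hX

theorem bracket_congr {X' Y' : VField M} (hX : X =ᶠ[𝓝 u] X') (hY : Y =ᶠ[𝓝 u] Y') :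
    bracket X Y u = bracket X' Y' u :=
  Filter.EventuallyEq.mlieBracket_vectorField_eq hX hY

theorem bracket_eventuallyEq {X' Y' : VField M} (hX : X =ᶠ[𝓝 u] X') (hY : Y =ᶠ[𝓝 u] Y') :
    bracket X Y =ᶠ[𝓝 u] bracket X' Y' := by
  filter_upwards [hX.eventuallyEq_nhds, hY.eventuallyEq_nhds] with w h1 h2
  exact bracket_congr h1 h2

theorem leibniz_bracket (hX : X.SmoothAt u) (hY : Y.SmoothAt u) (hZ : Z.SmoothAt u) :
    bracket X (bracket Y Z) u = bracket (bracket X Y) Z u + bracket Y (bracket X Z) u := by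
  refine VectorField.leibniz_identity_mlieBracket_apply (hX.of_le ?_) (hY.of_le ?_) (hZ.of_le ?_)
  all_goals simp only [minSmoothness_of_isRCLikeNormedField]; exact WithTop.coe_le_coe.2 le_top

/-! ### Derivatives of functions -/

theorem differential_congr (h : f =ᶠ[𝓝 u] g) : differential f u = differential g u := by
  unfold differential; exact h.mfderiv_eq

theorem dirDeriv_congr (h : f =ᶠ[𝓝 u] g) : dirDeriv X f u = dirDeriv X g u := by
  unfold dirDeriv; rw [differential_congr h]

theorem dirDeriv_add (hf : FunDiffAt f u) (hg : FunDiffAt g u) :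
    dirDeriv X (fun w => f w + g w) u = dirDeriv X f u + dirDeriv X g u := by
  have := mvfderiv_fun_add hf hg
  exact congrArg (fun l => l (X u)) this

theorem dirDeriv_mul (hf : FunDiffAt f u) (hg : FunDiffAt g u) :
    dirDeriv X (fun w => f w * g w) u = f u * dirDeriv X g u + g u * dirDeriv X f u := by
  have := mvfderiv_fun_mul hf hg
  exact congrArg (fun l => l (X u)) this

theorem dirDeriv_const (c : ℝ) : dirDeriv X (fun _ => c) u = 0 := by
  have := mvfderiv_const (I := 𝓘(ℝ, Plane).tangent) (M := TB M) c (x := u)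
  exact congrArg (fun l => l (X u)) this

theorem dirDeriv_const_mul (c : ℝ) (hf : FunDiffAt f u) :
    dirDeriv X (fun w => c * f w) u = c * dirDeriv X f u := by
  rw [dirDeriv_mul (FunSmoothAt.const c).diffAt hf, dirDeriv_const, mul_zero, add_zero]

theorem dirDeriv_eq_zero_of_eventually (h : ∀ᶠ w in 𝓝 u, f w = 0) : dirDeriv X f u = 0 := by
  rw [dirDeriv_congr (g := fun _ => 0) h, dirDeriv_const]

theorem dirDeriv_inv (hf : FunSmoothAt f u) (h0 : f u ≠ 0) :
    dirDeriv X (fun w => (f w)⁻¹) u = - dirDeriv X f u / f u ^ 2 := by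
  have hc : ContinuousAt f u := hf.continuousAt
  have h1 : (fun w => f w * (f w)⁻¹) =ᶠ[𝓝 u] fun _ => 1 :=
    (hc.eventually_ne h0).mono fun w hw => mul_inv_cancel₀ hw
  have h2 := dirDeriv_congr (X := X) h1
  rw [dirDeriv_const, dirDeriv_mul hf.diffAt (hf.inv h0).diffAt] at h2
  field_simp at h2 ⊢
  linarith

@[simp] theorem dirDeriv_add_left : dirDeriv (X + Y) f u = dirDeriv X f u + dirDeriv Y f u :=
  (differential f u).map_add _ _

@[simp] theorem dirDeriv_smul_left : dirDeriv (g • X) f u = g u * dirDeriv X f u :=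
  (differential f u).map_smul (g u) _

/-- An extension of a tangent vector to a vector field, smooth near its base point. -/
theorem exists_extension (ξ : TTB u) :
    ∃ X : VField M, X u = ξ ∧ ∀ᶠ w in 𝓝 u, X.SmoothAt w := by
  obtain ⟨s, hs, h⟩ := FiberBundle.exists_contMDiffOn_extend (k := ∞) (𝓘(ℝ, Plane).tangent)
    (Plane × Plane) (V := fun w : TB M => TTB w) ξ
  refine ⟨FiberBundle.extend (Plane × Plane) ξ, by simp, ?_⟩
  filter_upwards [eventually_eventually_nhds.2 hs] with w hw
  exact h.contMDiffAt hw

theorem FunSmoothAt.dirDeriv (hf : FunSmoothAt f u) (hX : X.SmoothAt u) :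
    FunSmoothAt (dirDeriv X f) u := by
  have h1 := ContMDiffAt.mfderiv_const (m := ∞) (n := ∞) hf (by simp)
  have h2 := ContMDiffAt.clm_apply_of_inCoordinates (b₁ := fun w : TB M => w) (b₂ := f)
    (E₂ := TangentSpace 𝓘(ℝ, ℝ)) (m₀ := u) (v := X)
    (ϕ := fun w => mfderiv (𝓘(ℝ, Plane).tangent) 𝓘(ℝ, ℝ) f w) h1 hX hf
  exact (contMDiff_snd_tangentBundle_modelSpace ℝ 𝓘(ℝ, ℝ)).contMDiffAt.comp u h2

instance (u : TB M) : Nontrivial (TTB u) := inferInstanceAs (Nontrivial (Plane × Plane))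

/-- A vector field acts on functions compatibly with the Lie bracket. -/
theorem dirDeriv_bracket (hX : X.SmoothAt u) (hY : Y.SmoothAt u) (hf : FunSmoothAt f u) :
    dirDeriv (bracket X Y) f u = dirDeriv X (dirDeriv Y f) u - dirDeriv Y (dirDeriv X f) u := by
  -- Expand the Jacobi identity for `X, Y, f • W` by the Leibniz rule and subtract `f` times the one
  -- for `X, Y, W`. What is left is the desired identity multiplied by `W u`, which is nonzero by
  -- choice.
  obtain ⟨ξ, hξ⟩ := exists_ne (0 : TTB u)
  obtain ⟨W, hWu, hW⟩ := exists_extension ξ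
  have hWs : W.SmoothAt u := hW.self_of_nhds
  have hfd := hf.eventually_diffAt
  have hWd := hW.mono fun w hw => VField.SmoothAt.diffAt hw
  have e : ∀ Z : VField M,
      bracket Z (f • W) =ᶠ[𝓝 u] BerwaldFrame.dirDeriv Z f • W + f • bracket Z W := by
    intro Z
    filter_upwards [hfd, hWd] with w h1 h2
    exact bracket_smul_right h1 h2
  have key : ∀ {X Y : VField M}, X.SmoothAt u → Y.SmoothAt u →
      bracket X (bracket Y (f • W)) u = dirDeriv X (dirDeriv Y f) u • W u
        + dirDeriv Y f u • bracket X W u + (dirDeriv X f u • bracket Y W u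
        + f u • bracket X (bracket Y W) u) := by
    intro X Y hX hY
    rw [bracket_congr (EventuallyEq.refl _ X) (e Y),
      bracket_add_right (VField.SmoothAt.smul (hf.dirDeriv hY) hWs).diffAt
        (VField.SmoothAt.smul hf (hY.bracket hWs)).diffAt,
      bracket_smul_right (hf.dirDeriv hY).diffAt hWs.diffAt,
      bracket_smul_right hf.diffAt (hY.bracket hWs).diffAt]
  have hl := leibniz_bracket hX hY (VField.SmoothAt.smul hf hWs)
  have hl2 := leibniz_bracket hX hY hWs
  rw [key hX hY, key hY hX, bracket_smul_right hf.diffAt hWs.diffAt, hl2] at hl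
  have h3 : (dirDeriv X (dirDeriv Y f) u - dirDeriv Y (dirDeriv X f) u -
      dirDeriv (bracket X Y) f u) • W u = 0 := by
    rw [sub_smul, sub_smul]
    rw [smul_add] at hl
    have := sub_eq_zero.2 hl
    rw [← this]; abel
  rw [hWu] at h3
  have := (smul_eq_zero.1 h3).resolve_right hξ
  linarith

/-! ### Bundle coordinates -/

section Coordinates

/-- The derivative of a plane-valued function on `TM`. -/
noncomputable def planeDeriv (G : TB M → Plane) (w : TB M) : TTB w →L[ℝ] Plane :=
  mfderiv (𝓘(ℝ, Plane).tangent) 𝓘(ℝ, Plane) G w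

/-- The base coordinates near the fibre over `p`. -/
noncomputable def baseCoord (p : M) (w : TB M) : Plane := extChartAt 𝓘(ℝ, Plane) p w.1

/-- The fibre coordinates near the fibre over `p`. -/
noncomputable def fibreCoord (p : M) (w : TB M) : Plane :=
  (trivializationAt Plane (TangentSpace 𝓘(ℝ, Plane)) p w).2

/-- The coordinate expression `T_qM → ℝ²` of tangent vectors, for `q` in the chart domain at `p`. -/
noncomputable def coordMap (p q : M) : Plane →L[ℝ] Plane :=
  (trivializationAt Plane (TangentSpace 𝓘(ℝ, Plane)) p).continuousLinearMapAt ℝ q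

variable {p q : M}

theorem coordMap_injective (hq : q ∈ (chartAt Plane p).source) :
    Function.Injective (coordMap p q) := by
  have h : q ∈ (trivializationAt Plane (TangentSpace 𝓘(ℝ, Plane)) p).baseSet := hq
  have e := Trivialization.coe_continuousLinearEquivAt_eq (R := ℝ)
    (trivializationAt Plane (TangentSpace 𝓘(ℝ, Plane)) p) h
  have hi := (Trivialization.continuousLinearEquivAt ℝ
    (trivializationAt Plane (TangentSpace 𝓘(ℝ, Plane)) p) q h).injective
  rw [e] at hi
  exact hi

theorem fibreCoord_eq {w : TB M} (hw : w.1 ∈ (chartAt Plane p).source) :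
    fibreCoord p w = coordMap p w.1 (vec w) := by
  have h : w.1 ∈ (trivializationAt Plane (TangentSpace 𝓘(ℝ, Plane)) p).baseSet := hw
  exact congrFun (Trivialization.coe_continuousLinearEquivAt_eq (R := ℝ)
    (trivializationAt Plane (TangentSpace 𝓘(ℝ, Plane)) p) h) w.2

theorem contMDiffAt_baseCoord {w : TB M} (hw : w.1 ∈ (chartAt Plane p).source) :
    ContMDiffAt (𝓘(ℝ, Plane).tangent) 𝓘(ℝ, Plane) ∞ (baseCoord p) w :=
  (contMDiffAt_extChartAt' hw).comp w (contMDiffAt_proj (TangentSpace 𝓘(ℝ, Plane)))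

theorem contMDiffAt_fibreCoord {w : TB M} (hw : w.1 ∈ (chartAt Plane p).source) :
    ContMDiffAt (𝓘(ℝ, Plane).tangent) 𝓘(ℝ, Plane) ∞ (fibreCoord p) w := by
  have h := (trivializationAt Plane (TangentSpace 𝓘(ℝ, Plane)) p).contMDiffAt_iff
    (IB := 𝓘(ℝ, Plane)) (IM := 𝓘(ℝ, Plane).tangent) (n := ∞) (f := id) (x₀ := w)
    (by rw [Trivialization.mem_source]; exact hw)
  exact (h.1 contMDiffAt_id).2

theorem projDeriv_eq {w : TB M} (hw : w.1 ∈ (chartAt Plane p).source) (ξ : TTB w) :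
    planeDeriv (baseCoord p) w ξ =
      coordMap p w.1 (projDeriv w ξ) := by
  unfold coordMap projDeriv planeDeriv
  rw [TangentBundle.continuousLinearMapAt_trivializationAt hw]
  exact congrArg (fun l => l ξ) (mfderiv_comp w (f := fun w : TB M => w.1)
    (mdifferentiableAt_extChartAt hw)
    ((contMDiffAt_proj (n := ∞) (TangentSpace 𝓘(ℝ, Plane))).mdifferentiableAt (by simp)))

theorem contMDiff_toTB (p : M) :
    ContMDiff 𝓘(ℝ, Plane) (𝓘(ℝ, Plane).tangent) ∞ (toTB p) := by
  intro a
  rw [contMDiffAt_totalSpace]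
  refine ⟨contMDiffAt_const, ?_⟩
  have : (fun x => (trivializationAt Plane (TangentSpace 𝓘(ℝ, Plane)) (toTB p a).1 (toTB p x)).2)
      = coordMap p p := by
    funext x
    exact fibreCoord_eq (p := p) (w := toTB p x) (mem_chart_source _ p)
  rw [this]
  exact (coordMap p p).contDiff.contMDiff.contMDiffAt

theorem mfderiv_fibreCoord_verticalLift {w : TB M} (hw : w.1 ∈ (chartAt Plane p).source)
    (a : Plane) :
    planeDeriv (fibreCoord p) w (verticalLift w a) =
      coordMap p w.1 a := by
  have h := mfderiv_comp (vec w) (f := toTB w.1) (g := fibreCoord p)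
    ((contMDiffAt_fibreCoord (w := w) hw).mdifferentiableAt (by simp))
    ((contMDiff_toTB w.1).contMDiffAt.mdifferentiableAt (by simp))
  have e : fibreCoord p ∘ toTB w.1 = coordMap p w.1 := by
    funext x
    exact fibreCoord_eq (p := p) (w := toTB w.1 x) hw
  rw [e, mfderiv_eq_fderiv, ContinuousLinearMap.fderiv] at h
  exact (congrArg (fun l => l a) h).symm

theorem projDeriv_verticalLift (w : TB M) (a : Plane) : projDeriv w (verticalLift w a) = 0 := by
  have h := mfderiv_comp (vec w) (f := toTB w.1) (g := fun w : TB M => w.1)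
    ((contMDiffAt_proj (n := ∞) (TangentSpace 𝓘(ℝ, Plane)) (p := w)).mdifferentiableAt (by simp))
    ((contMDiff_toTB w.1).contMDiffAt.mdifferentiableAt (by simp))
  have e : (fun w : TB M => w.1) ∘ toTB w.1 = fun _ => w.1 := rfl
  rw [e, mfderiv_const] at h
  exact (congrArg (fun l => l a) h).symm

theorem mfderiv_extChartAt_eq {v w : TB M} (hw : w.1 ∈ (chartAt Plane v.1).source) (ξ : TTB w) :
    (mfderiv (𝓘(ℝ, Plane).tangent) 𝓘(ℝ, Plane × Plane) (extChartAt (𝓘(ℝ, Plane).tangent) v) w ξ :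
      Plane × Plane) =
      (planeDeriv (baseCoord v.1) w ξ,
        planeDeriv (fibreCoord v.1) w ξ) := by
  have e : ∀ z : TB M,
      extChartAt (𝓘(ℝ, Plane).tangent) v z = (baseCoord v.1 z, fibreCoord v.1 z) := by
    intro z
    have := FiberBundle.extChartAt (IB := 𝓘(ℝ, Plane)) (F := Plane)
      (E := fun p : M => TangentSpace 𝓘(ℝ, Plane) p) v
    exact congrArg (fun f : PartialEquiv (TB M) (Plane × Plane) => f z) this
  have hd : MDifferentiableAt (𝓘(ℝ, Plane).tangent) 𝓘(ℝ, Plane × Plane)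
      (extChartAt (𝓘(ℝ, Plane).tangent) v) w :=
    mdifferentiableAt_extChartAt ((TangentBundle.mem_chart_source_iff w v).2 hw)
  have h1 := mfderiv_comp (I := 𝓘(ℝ, Plane).tangent) (I'' := 𝓘(ℝ, Plane)) w
    (g := ContinuousLinearMap.fst ℝ Plane Plane)
    ((ContinuousLinearMap.fst ℝ Plane Plane).differentiableAt.mdifferentiableAt) hd
  have h2 := mfderiv_comp (I := 𝓘(ℝ, Plane).tangent) (I'' := 𝓘(ℝ, Plane)) w
    (g := ContinuousLinearMap.snd ℝ Plane Plane)
    ((ContinuousLinearMap.snd ℝ Plane Plane).differentiableAt.mdifferentiableAt) hd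
  have e1 : ContinuousLinearMap.fst ℝ Plane Plane ∘ extChartAt (𝓘(ℝ, Plane).tangent) v =
      baseCoord v.1 := funext fun z => congrArg Prod.fst (e z)
  have e2 : ContinuousLinearMap.snd ℝ Plane Plane ∘ extChartAt (𝓘(ℝ, Plane).tangent) v =
      fibreCoord v.1 := funext fun z => congrArg Prod.snd (e z)
  rw [e1, mfderiv_eq_fderiv, ContinuousLinearMap.fderiv] at h1
  rw [e2, mfderiv_eq_fderiv, ContinuousLinearMap.fderiv] at h2
  exact Prod.ext (congrArg (fun l => l ξ) h1).symm (congrArg (fun l => l ξ) h2).symm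

/-- The components of the base coordinates. -/
noncomputable def xCoord (p : M) (i : Fin 2) (w : TB M) : ℝ := baseCoord p w i

/-- The components of the fibre coordinates. -/
noncomputable def yCoord (p : M) (i : Fin 2) (w : TB M) : ℝ := fibreCoord p w i

theorem smoothAt_xCoord {w : TB M} (hw : w.1 ∈ (chartAt Plane p).source) (i : Fin 2) :
    FunSmoothAt (xCoord p i) w :=
  (EuclideanSpace.proj (𝕜 := ℝ) i : Plane →L[ℝ] ℝ).contDiff.contMDiff.contMDiffAt.comp w
    (contMDiffAt_baseCoord hw)

theorem smoothAt_yCoord {w : TB M} (hw : w.1 ∈ (chartAt Plane p).source) (i : Fin 2) :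
    FunSmoothAt (yCoord p i) w :=
  (EuclideanSpace.proj (𝕜 := ℝ) i : Plane →L[ℝ] ℝ).contDiff.contMDiff.contMDiffAt.comp w
    (contMDiffAt_fibreCoord hw)

theorem mfderiv_component {G : TB M → Plane} {w : TB M}
    (hG : MDifferentiableAt (𝓘(ℝ, Plane).tangent) 𝓘(ℝ, Plane) G w) (i : Fin 2) (ξ : TTB w) :
    differential (fun z => G z i) w ξ =
      planeDeriv G w ξ i := by
  have h := mfderiv_comp (I := 𝓘(ℝ, Plane).tangent) (I'' := 𝓘(ℝ, ℝ)) w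
    (g := (EuclideanSpace.proj (𝕜 := ℝ) i : Plane →L[ℝ] ℝ))
    ((EuclideanSpace.proj (𝕜 := ℝ) i : Plane →L[ℝ] ℝ).differentiableAt.mdifferentiableAt) hG
  rw [mfderiv_eq_fderiv, ContinuousLinearMap.fderiv] at h
  exact congrArg (fun l => l ξ) h

theorem differential_xCoord {w : TB M} (hw : w.1 ∈ (chartAt Plane p).source) (i : Fin 2)
    (ξ : TTB w) : differential (xCoord p i) w ξ = coordMap p w.1 (projDeriv w ξ) i := by
  rw [← projDeriv_eq hw]
  exact mfderiv_component ((contMDiffAt_baseCoord hw).mdifferentiableAt (by simp)) i ξ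

theorem differential_yCoord_verticalLift {w : TB M} (hw : w.1 ∈ (chartAt Plane p).source)
    (i : Fin 2) (a : Plane) :
    differential (yCoord p i) w (verticalLift w a) = coordMap p w.1 a i := by
  rw [← mfderiv_fibreCoord_verticalLift hw]
  exact mfderiv_component ((contMDiffAt_fibreCoord hw).mdifferentiableAt (by simp)) i _

theorem yCoord_eq {w : TB M} (hw : w.1 ∈ (chartAt Plane p).source) (i : Fin 2) :
    yCoord p i w = coordMap p w.1 (vec w) i := by
  unfold yCoord; rw [fibreCoord_eq hw]

theorem differential_xCoord_tangentStr {w : TB M} (hw : w.1 ∈ (chartAt Plane p).source)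
    (i : Fin 2) (ξ : TTB w) : differential (xCoord p i) w (tangentStr w ξ) = 0 := by
  rw [differential_xCoord hw]
  simp [tangentStr, projDeriv_verticalLift]

/-- Together with the vanishing on `xCoord`, this is the coordinate form `J = ∂/∂yⁱ ⊗ dxⁱ`. It is
the form in which `J` is used in coordinate computations. -/
theorem differential_yCoord_tangentStr {w : TB M} (hw : w.1 ∈ (chartAt Plane p).source)
    (i : Fin 2) (ξ : TTB w) :
    differential (yCoord p i) w (tangentStr w ξ) = differential (xCoord p i) w ξ := by
  rw [differential_xCoord hw, ← differential_yCoord_verticalLift hw]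
  rfl

/-- The four functions are the components of a chart of `TM`, whose differential is invertible on
its source. Equalities of tangent vectors can therefore be tested on coordinates. -/
theorem tangent_ext {w : TB M} (hw : w.1 ∈ (chartAt Plane p).source) {ξ η : TTB w}
    (hx : ∀ i, differential (xCoord p i) w ξ = differential (xCoord p i) w η)
    (hy : ∀ i, differential (yCoord p i) w ξ = differential (yCoord p i) w η) : ξ = η := by
  -- The chart of `TM` at a point depends only on its base point, so the zero vector over `p` is a
  -- convenient representative.
  have hinj := (isInvertible_mfderiv_extChartAt (I := 𝓘(ℝ, Plane).tangent) (x := toTB p 0) (y := w)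
    (by rw [extChartAt_source]; exact (TangentBundle.mem_chart_source_iff w _).2 hw)).injective
  apply hinj
  refine (mfderiv_extChartAt_eq (v := toTB p 0) hw ξ).trans
    (Eq.trans ?_ (mfderiv_extChartAt_eq (v := toTB p 0) hw η).symm)
  refine Prod.ext ?_ ?_
  · ext i
    have := hx i
    unfold xCoord at this
    rwa [mfderiv_component ((contMDiffAt_baseCoord hw).mdifferentiableAt (by simp)),
      mfderiv_component ((contMDiffAt_baseCoord hw).mdifferentiableAt (by simp))] at this
  · ext i
    have := hy i
    unfold yCoord at this
    rwa [mfderiv_component ((contMDiffAt_fibreCoord hw).mdifferentiableAt (by simp)),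
      mfderiv_component ((contMDiffAt_fibreCoord hw).mdifferentiableAt (by simp))] at this

theorem trivialization_eventuallyEq {w : TB M} (hw : w.1 ∈ (chartAt Plane p).source)
    (X : VField M) :
    (fun z => (trivializationAt (Plane × Plane) (TangentSpace (𝓘(ℝ, Plane).tangent))
      (toTB p 0) ⟨z, X z⟩).2) =ᶠ[𝓝 w]
    fun z => (dirDeriv X (xCoord p 0) z • ((EuclideanSpace.single 0 1, 0) : Plane × Plane) +
      dirDeriv X (xCoord p 1) z • ((EuclideanSpace.single 1 1, 0) : Plane × Plane)) +
      (dirDeriv X (yCoord p 0) z • ((0, EuclideanSpace.single 0 1) : Plane × Plane) +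
      dirDeriv X (yCoord p 1) z • ((0, EuclideanSpace.single 1 1) : Plane × Plane)) := by
  have ho : ∀ᶠ z : TB M in 𝓝 w, z.1 ∈ (chartAt Plane p).source :=
    (FiberBundle.continuous_proj Plane (TangentSpace 𝓘(ℝ, Plane))).continuousAt.eventually
      ((chartAt Plane p).open_source.mem_nhds hw)
  filter_upwards [ho] with z hz
  have hb : z ∈ (chartAt (ModelProd Plane Plane) (toTB p 0)).source :=
    (TangentBundle.mem_chart_source_iff z _).2 hz
  have hb' : z ∈ (trivializationAt (Plane × Plane) (TangentSpace (𝓘(ℝ, Plane).tangent))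
      (toTB p 0)).baseSet := hb
  have e := mfderiv_extChartAt_eq (v := toTB p 0) hz (X z)
  have e1 : (trivializationAt (Plane × Plane) (TangentSpace (𝓘(ℝ, Plane).tangent))
      (toTB p 0) ⟨z, X z⟩).2 = mfderiv (𝓘(ℝ, Plane).tangent) 𝓘(ℝ, Plane × Plane)
        (extChartAt (𝓘(ℝ, Plane).tangent) (toTB p 0)) z (X z) := by
    rw [← TangentBundle.continuousLinearMapAt_trivializationAt hb]
    exact congrFun (Trivialization.coe_continuousLinearEquivAt_eq (R := ℝ) _ hb') (X z)
  refine (e1.trans e).trans ?_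
  unfold dirDeriv xCoord yCoord
  rw [mfderiv_component ((contMDiffAt_baseCoord hz).mdifferentiableAt (by simp)),
      mfderiv_component ((contMDiffAt_baseCoord hz).mdifferentiableAt (by simp)),
      mfderiv_component ((contMDiffAt_fibreCoord hz).mdifferentiableAt (by simp)),
      mfderiv_component ((contMDiffAt_fibreCoord hz).mdifferentiableAt (by simp))]
  refine Prod.ext ?_ ?_
  · ext i; fin_cases i <;> simp [toTB]
  · ext i; fin_cases i <;> simp [toTB]

/-- In the trivialization of the double tangent bundle the components of `X` are exactly `X(xⁱ)` and
`X(yⁱ)`. -/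
theorem smoothAt_of_coord {w : TB M} (hw : w.1 ∈ (chartAt Plane p).source) {X : VField M}
    (hx : ∀ i, FunSmoothAt (dirDeriv X (xCoord p i)) w)
    (hy : ∀ i, FunSmoothAt (dirDeriv X (yCoord p i)) w) : X.SmoothAt w := by
  refine ((trivializationAt (Plane × Plane) (TangentSpace (𝓘(ℝ, Plane).tangent))
      (toTB p 0)).contMDiffAt_section_iff (n := ∞) (x₀ := w)
      ((TangentBundle.mem_chart_source_iff w _).2 hw)).2 ?_
  refine ContMDiffAt.congr_of_eventuallyEq ?_ (trivialization_eventuallyEq hw X)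
  exact ((ContMDiffAt.smul (hx 0) contMDiffAt_const).add
    (ContMDiffAt.smul (hx 1) contMDiffAt_const)).add ((ContMDiffAt.smul (hy 0)
      contMDiffAt_const).add (ContMDiffAt.smul (hy 1) contMDiffAt_const))

theorem diffAt_of_coord {w : TB M} (hw : w.1 ∈ (chartAt Plane p).source) {X : VField M}
    (hx : ∀ i, FunDiffAt (dirDeriv X (xCoord p i)) w)
    (hy : ∀ i, FunDiffAt (dirDeriv X (yCoord p i)) w) : X.DiffAt w := by
  refine ((trivializationAt (Plane × Plane) (TangentSpace (𝓘(ℝ, Plane).tangent))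
      (toTB p 0)).mdifferentiableAt_section_iff (𝓘(ℝ, Plane).tangent) _
      ((TangentBundle.mem_chart_source_iff w _).2 hw)).2 ?_
  refine MDifferentiableAt.congr_of_eventuallyEq ?_ (trivialization_eventuallyEq hw X)
  exact ((MDifferentiableAt.smul (hx 0) mdifferentiableAt_const).add
    (MDifferentiableAt.smul (hx 1) mdifferentiableAt_const)).add ((MDifferentiableAt.smul (hy 0)
      mdifferentiableAt_const).add (MDifferentiableAt.smul (hy 1) mdifferentiableAt_const))

theorem FunSmoothAt.dirDeriv_diffAt (hf : FunSmoothAt f u) (hX : X.DiffAt u) :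
    FunDiffAt (BerwaldFrame.dirDeriv X f) u := by
  have h1 := ContMDiffAt.mfderiv_const (m := ∞) (n := ∞) hf (by simp)
  have h2 := MDifferentiableAt.clm_apply_of_inCoordinates (b₁ := fun w : TB M => w) (b₂ := f)
    (E₂ := TangentSpace 𝓘(ℝ, ℝ)) (m₀ := u) (v := X)
    (ϕ := fun w => mfderiv (𝓘(ℝ, Plane).tangent) 𝓘(ℝ, ℝ) f w)
    (h1.mdifferentiableAt (by simp)) hX hf.diffAt
  exact ((contMDiff_snd_tangentBundle_modelSpace (n := 1) ℝ 𝓘(ℝ, ℝ)).contMDiffAt.mdifferentiableAt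
    (by simp)).comp u h2

end Coordinates

/-! ### The tangent structure -/

section TangentStructure

theorem eventually_mem_source (u : TB M) : ∀ᶠ w : TB M in 𝓝 u, w.1 ∈ (chartAt Plane u.1).source :=
  (FiberBundle.continuous_proj Plane (TangentSpace 𝓘(ℝ, Plane))).continuousAt.eventually
    ((chartAt Plane u.1).open_source.mem_nhds (mem_chart_source _ _))

theorem tangentStr_tangentStr (ξ : TTB u) : tangentStr u (tangentStr u ξ) = 0 := by
  simp [tangentStr, projDeriv_verticalLift]

theorem J_J (X : VField M) : J (J X) = 0 := by
  funext w; exact tangentStr_tangentStr (X w)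

theorem tangentStr_liouville : tangentStr u (liouville M u) = 0 := by
  simp [tangentStr, liouville, projDeriv_verticalLift]

theorem J_add (X Y : VField M) : J (X + Y) = J X + J Y := by
  funext w; exact (tangentStr w).map_add _ _

theorem J_neg (X : VField M) : J (-X) = - J X := by
  funext w; exact (tangentStr w).map_neg _

theorem J_smul (f : TB M → ℝ) (X : VField M) : J (f • X) = f • J X := by
  funext w; exact (tangentStr w).map_smul _ _

theorem J_eventuallyEq (h : X =ᶠ[𝓝 u] Y) : J X =ᶠ[𝓝 u] J Y :=
  h.mono fun w hw => by unfold J; rw [hw]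

theorem verticalLift_injective (u : TB M) : Function.Injective (verticalLift u) := by
  intro a b h
  apply coordMap_injective (mem_chart_source Plane u.1)
  ext i
  rw [← differential_yCoord_verticalLift (mem_chart_source Plane u.1), h,
    differential_yCoord_verticalLift (mem_chart_source Plane u.1)]

theorem tangentStr_eq_zero_iff {ξ : TTB u} : tangentStr u ξ = 0 ↔ projDeriv u ξ = 0 := by
  constructor
  · intro h
    apply verticalLift_injective u
    rw [map_zero]; exact h
  · intro h
    simp [tangentStr, h]

/-- Vertical vectors are vertical lifts. -/
theorem exists_verticalLift {ξ : TTB u} (h : tangentStr u ξ = 0) : ∃ a, ξ = verticalLift u a := by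
  have hu := mem_chart_source Plane u.1
  have hsurj : Function.Surjective (coordMap u.1 u.1) :=
    (LinearMap.injective_iff_surjective (f := (coordMap u.1 u.1).toLinearMap)).1
      (coordMap_injective hu)
  obtain ⟨a, ha⟩ := hsurj (planeDeriv (fibreCoord u.1) u ξ)
  refine ⟨a, tangent_ext hu ?_ ?_⟩ <;> intro i
  · rw [differential_xCoord hu, differential_xCoord hu, tangentStr_eq_zero_iff.1 h,
      projDeriv_verticalLift]
  · rw [differential_yCoord_verticalLift hu, ha]
    exact mfderiv_component ((contMDiffAt_fibreCoord hu).mdifferentiableAt (by simp)) i ξ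

/-- Dimension count: the kernel is the image of the injective vertical lift, so it has dimension 2
inside a space of dimension 4. -/
theorem projDeriv_surjective (u : TB M) : Function.Surjective (projDeriv u) := by
  have h : LinearMap.range (verticalLift u).toLinearMap =
      LinearMap.ker (projDeriv u).toLinearMap := by
    ext ξ
    constructor
    · rintro ⟨a, rfl⟩
      exact projDeriv_verticalLift u a
    · intro hξ
      obtain ⟨a, ha⟩ := exists_verticalLift (tangentStr_eq_zero_iff.2 hξ)
      exact ⟨a, ha.symm⟩
  have hfd : FiniteDimensional ℝ (TTB u) := inferInstanceAs (FiniteDimensional ℝ (Plane × Plane))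
  have h1 := LinearMap.finrank_range_add_finrank_ker (projDeriv u).toLinearMap
  rw [← h, LinearMap.finrank_range_of_inj (verticalLift_injective u)] at h1
  have h2 : Module.finrank ℝ (TTB u) = 4 := by
    change Module.finrank ℝ (Plane × Plane) = 4
    simp
  have h3 : Module.finrank ℝ Plane = 2 := by simp
  have h4 : LinearMap.range (projDeriv u).toLinearMap = ⊤ := by
    apply Submodule.eq_top_of_finrank_eq
    omega
  exact LinearMap.range_eq_top.1 h4

theorem exists_tangentStr {ξ : TTB u} (h : tangentStr u ξ = 0) : ∃ ζ, ξ = tangentStr u ζ := by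
  obtain ⟨a, rfl⟩ := exists_verticalLift h
  obtain ⟨ζ, rfl⟩ := projDeriv_surjective u a
  exact ⟨ζ, rfl⟩

theorem dirDeriv_J_xCoord (X : VField M) (u : TB M) (i : Fin 2) :
    ∀ᶠ w in 𝓝 u, dirDeriv (J X) (xCoord u.1 i) w = 0 :=
  (eventually_mem_source u).mono fun _ hw => differential_xCoord_tangentStr hw i _

theorem dirDeriv_J_yCoord (X : VField M) (u : TB M) (i : Fin 2) :
    ∀ᶠ w in 𝓝 u, dirDeriv (J X) (yCoord u.1 i) w = dirDeriv X (xCoord u.1 i) w :=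
  (eventually_mem_source u).mono fun _ hw => differential_yCoord_tangentStr hw i _

theorem VField.SmoothAt.J (hX : X.SmoothAt u) : (J X).SmoothAt u := by
  have hu := mem_chart_source Plane u.1
  refine smoothAt_of_coord hu (fun i => ?_) (fun i => ?_)
  · exact (FunSmoothAt.const 0).congr (dirDeriv_J_xCoord X u i)
  · exact ((smoothAt_xCoord hu i).dirDeriv hX).congr (dirDeriv_J_yCoord X u i)

theorem VField.DiffAt.J (hX : X.DiffAt u) : (J X).DiffAt u := by
  have hu := mem_chart_source Plane u.1
  refine diffAt_of_coord hu (fun i => ?_) (fun i => ?_)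
  · exact MDifferentiableAt.congr_of_eventuallyEq (FunSmoothAt.const 0).diffAt
      (dirDeriv_J_xCoord X u i)
  · exact MDifferentiableAt.congr_of_eventuallyEq ((smoothAt_xCoord hu i).dirDeriv_diffAt hX)
      (dirDeriv_J_yCoord X u i)

theorem dirDeriv_liouville_yCoord (u : TB M) (i : Fin 2) :
    dirDeriv (liouville M) (yCoord u.1 i) =ᶠ[𝓝 u] yCoord u.1 i :=
  (eventually_mem_source u).mono fun w hw =>
    (differential_yCoord_verticalLift hw i (vec w)).trans (yCoord_eq hw i).symm

theorem smoothAt_liouville (u : TB M) : (liouville M).SmoothAt u := by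
  have hu := mem_chart_source Plane u.1
  refine smoothAt_of_coord hu (fun i => ?_) (fun i => ?_)
  · refine (FunSmoothAt.const 0).congr ((eventually_mem_source u).mono fun w hw => ?_)
    refine (differential_xCoord hw i _).trans ?_
    simp [liouville, projDeriv_verticalLift]
  · exact (smoothAt_yCoord hu i).congr (dirDeriv_liouville_yCoord u i)

/-- The other term of the bracket vanishes because `J X` kills the base coordinates. -/
theorem bracket_J_xCoord (hX : X.SmoothAt u) (hY : Y.SmoothAt u) (i : Fin 2) :
    dirDeriv (bracket (J X) Y) (xCoord u.1 i) u =
      dirDeriv (J X) (dirDeriv Y (xCoord u.1 i)) u := by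
  rw [dirDeriv_bracket hX.J hY (smoothAt_xCoord (mem_chart_source Plane u.1) i),
    dirDeriv_eq_zero_of_eventually (dirDeriv_J_xCoord X u i), sub_zero]

end TangentStructure

/-! ### Sprays -/

section Spray

theorem isOpen_slit : IsOpen (slit M) := by
  rw [isOpen_iff_mem_nhds]
  intro u hu
  have hs := mem_chart_source Plane u.1
  have h0 : fibreCoord u.1 u ≠ 0 := by
    rw [fibreCoord_eq hs]
    intro h
    exact hu (coordMap_injective hs (h.trans (map_zero _).symm))
  filter_upwards [eventually_mem_source u,
    (contMDiffAt_fibreCoord hs).continuousAt.eventually_ne h0] with w hw h1 h2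
  apply h1
  rw [fibreCoord_eq hw, h2, map_zero]

theorem eventually_mem_slit (hu : u ∈ slit M) : ∀ᶠ w in 𝓝 u, w ∈ slit M :=
  isOpen_slit.mem_nhds hu

variable {S : VField M}

theorem IsSpray.smoothAt (hS : IsSpray S) (hu : u ∈ slit M) : S.SmoothAt u := hS.smooth u hu

theorem IsSpray.J_eventuallyEq (hS : IsSpray S) (hu : u ∈ slit M) :
    J S =ᶠ[𝓝 u] liouville M :=
  (eventually_mem_slit hu).mono fun w hw => hS.second_order w hw

theorem IsSpray.dirDeriv_xCoord (hS : IsSpray S) (hu : u ∈ slit M) (i : Fin 2) :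
    dirDeriv S (xCoord u.1 i) =ᶠ[𝓝 u] yCoord u.1 i := by
  filter_upwards [dirDeriv_J_yCoord S u i, dirDeriv_liouville_yCoord u i,
    hS.J_eventuallyEq hu] with w h1 h2 h3
  rw [← h1, ← h2]
  unfold dirDeriv; rw [h3]

/-- Since `S(xⁱ) = yⁱ` and `X(xⁱ) = 0`, one has `[S, X](xⁱ) = -X(yⁱ)`, and `J` moves this to the
`yⁱ` component. This identity yields the algebra of `h`, `v` and `J`. -/
theorem IsSpray.J_bracket (hS : IsSpray S) (hu : u ∈ slit M) (hX : X.SmoothAt u)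
    (hv : ∀ᶠ w in 𝓝 u, J X w = 0) : J (bracket S X) u = - X u := by
  have hs := mem_chart_source Plane u.1
  have hX0 : ∀ i, ∀ᶠ w in 𝓝 u, dirDeriv X (xCoord u.1 i) w = 0 := by
    intro i
    filter_upwards [eventually_mem_source u, hv] with w hw h
    refine (differential_xCoord hw i _).trans ?_
    rw [tangentStr_eq_zero_iff.1 h]; simp
  refine tangent_ext hs (fun i => ?_) (fun i => ?_)
  · rw [map_neg]
    change dirDeriv (J _) _ u = - dirDeriv X _ u
    rw [(hX0 i).self_of_nhds, (dirDeriv_J_xCoord _ u i).self_of_nhds, neg_zero]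
  · rw [map_neg]
    change dirDeriv (J _) _ u = - dirDeriv X _ u
    rw [(dirDeriv_J_yCoord _ u i).self_of_nhds,
      dirDeriv_bracket (hS.smoothAt hu) hX (smoothAt_xCoord hs i),
      dirDeriv_eq_zero_of_eventually (hX0 i), dirDeriv_congr (hS.dirDeriv_xCoord hu i), zero_sub]

theorem IsSpray.J_bracket_J (hS : IsSpray S) (hu : u ∈ slit M) (hX : X.SmoothAt u) :
    J (bracket S (J X)) u = - J X u :=
  hS.J_bracket hu hX.J (Eventually.of_forall fun w => congrFun (J_J X) w)

theorem VField.SmoothAt.connection (hS : S.SmoothAt u) (hX : X.SmoothAt u) :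
    (connection S X).SmoothAt u :=
  (hX.J.bracket hS).sub (hX.bracket hS).J

theorem VField.SmoothAt.hProj (hS : S.SmoothAt u) (hX : X.SmoothAt u) :
    (hProj S X).SmoothAt u :=
  (hX.add (hS.connection hX)).const_smul _

theorem VField.SmoothAt.vProj (hS : S.SmoothAt u) (hX : X.SmoothAt u) :
    (vProj S X).SmoothAt u :=
  (hX.sub (hS.connection hX)).const_smul _

theorem VField.SmoothAt.lieH (hS : S.SmoothAt u) (hX : X.SmoothAt u) :
    (lieH S X).SmoothAt u :=
  (hS.bracket (hS.hProj hX)).sub (hS.hProj (hS.bracket hX))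

theorem VField.SmoothAt.jacobi (hS : S.SmoothAt u) (hX : X.SmoothAt u) :
    (jacobi S X).SmoothAt u := hS.vProj (hS.lieH hX)

theorem connection_apply (S X : VField M) (u : TB M) :
    connection S X u = bracket (J X) S u - tangentStr u (bracket X S u) := rfl

theorem hProj_apply (S X : VField M) (u : TB M) :
    hProj S X u = (1 / 2 : ℝ) • (X u + connection S X u) := rfl

theorem vProj_apply (S X : VField M) (u : TB M) :
    vProj S X u = X u - hProj S X u := by
  rw [hProj_apply]
  change (1 / 2 : ℝ) • (X u - connection S X u) = _
  module

/-- The terms `S(f) J X` produced by `[f J X, S]` and by `J[f X, S]` cancel. -/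
theorem tensorialAt_hProj (S : VField M) (u : TB M) :
    TensorialAt (𝓘(ℝ, Plane).tangent) (Plane × Plane) (V := fun w : TB M => TTB w)
      (fun X : VField M => hProj S X u) u where
  smul {f X} hf hX := by
    have hX' : VField.DiffAt X u := hX
    rw [hProj_apply, hProj_apply, connection_apply, connection_apply, J_smul,
      bracket_smul_left hf hX'.J, bracket_smul_left hf hX', map_add, map_smul, map_smul]
    change (1 / 2 : ℝ) • (f u • X u + (- dirDeriv S f u • tangentStr u (X u) +
      f u • bracket (J X) S u - _)) = _
    module
  add {X Y} hX hY := by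
    have hX' : VField.DiffAt X u := hX
    have hY' : VField.DiffAt Y u := hY
    rw [hProj_apply, hProj_apply, hProj_apply, connection_apply, connection_apply,
      connection_apply, J_add, bracket_add_left hX'.J hY'.J, bracket_add_left hX' hY', map_add]
    change (1 / 2 : ℝ) • ((X u + Y u) + _) = _
    module

/-- The horizontal projector as a linear map of `T_u TM`. -/
noncomputable def horMap (S : VField M) (u : TB M) : TTB u →L[ℝ] TTB u :=
  TensorialAt.mkHom _ u (tensorialAt_hProj S u)

theorem hProj_eq_horMap (hX : X.DiffAt u) : hProj S X u = horMap S u (X u) :=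
  (TensorialAt.mkHom_apply (tensorialAt_hProj S u) hX).symm

theorem vProj_eq_horMap (hX : X.DiffAt u) : vProj S X u = X u - horMap S u (X u) := by
  rw [vProj_apply, hProj_eq_horMap hX]

theorem hProj_congr (h : X =ᶠ[𝓝 u] Y) : hProj S X u = hProj S Y u := by
  rw [hProj_apply, hProj_apply, connection_apply, connection_apply,
    bracket_congr (J_eventuallyEq h) (EventuallyEq.refl _ S),
    bracket_congr h (EventuallyEq.refl _ S), h.self_of_nhds]

theorem IsSpray.tangentStr_horMap (hS : IsSpray S) (hu : u ∈ slit M) (ξ : TTB u) :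
    tangentStr u (horMap S u ξ) = tangentStr u ξ := by
  obtain ⟨X, rfl, hX⟩ := exists_extension ξ
  have hX := hX.self_of_nhds
  rw [← hProj_eq_horMap hX.diffAt, hProj_apply, connection_apply, map_smul, map_add, map_sub,
    tangentStr_tangentStr, bracket_swap, map_neg]
  have h : tangentStr u (bracket S (J X) u) = - tangentStr u (X u) := hS.J_bracket_J hu hX
  rw [h]
  module

theorem IsSpray.hProj_of_vertical (hS : IsSpray S) (hu : u ∈ slit M) (hX : X.SmoothAt u)
    (hv : ∀ᶠ w in 𝓝 u, J X w = 0) : hProj S X u = 0 := by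
  have h0 : J X =ᶠ[𝓝 u] (0 : VField M) := hv
  have h1 : tangentStr u (bracket S X u) = - X u := hS.J_bracket hu hX hv
  rw [hProj_apply, connection_apply, bracket_congr h0 (EventuallyEq.refl _ S),
    bracket_swap (X := X),
    map_neg, h1]
  have h2 : bracket (0 : VField M) S u = 0 :=
    congrFun (VectorField.mlieBracket_zero_left (I := 𝓘(ℝ, Plane).tangent) (W := S)) u
  rw [h2]
  module

theorem IsSpray.horMap_tangentStr (hS : IsSpray S) (hu : u ∈ slit M) (ξ : TTB u) :
    horMap S u (tangentStr u ξ) = 0 := by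
  obtain ⟨X, rfl, hX⟩ := exists_extension ξ
  have hX := hX.self_of_nhds
  have h := hS.hProj_of_vertical hu hX.J (Eventually.of_forall fun w => congrFun (J_J X) w)
  rwa [hProj_eq_horMap hX.J.diffAt] at h

theorem IsSpray.horMap_of_vertical (hS : IsSpray S) (hu : u ∈ slit M) {ξ : TTB u}
    (h : tangentStr u ξ = 0) : horMap S u ξ = 0 := by
  obtain ⟨ζ, rfl⟩ := exists_tangentStr h
  exact hS.horMap_tangentStr hu ζ

/-- As `J h = J`, the difference `ξ - h ξ` is vertical, and `h` kills vertical vectors. -/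
theorem IsSpray.horMap_horMap (hS : IsSpray S) (hu : u ∈ slit M) (ξ : TTB u) :
    horMap S u (horMap S u ξ) = horMap S u ξ := by
  have h := hS.horMap_of_vertical hu (ξ := ξ - horMap S u ξ)
    (by rw [map_sub, hS.tangentStr_horMap hu, sub_self])
  rw [map_sub] at h
  exact (sub_eq_zero.1 h).symm

/-- Pointwise form of the second-order condition, for use under `tangentStr`. -/
theorem IsSpray.tangentStr_self (hS : IsSpray S) (hu : u ∈ slit M) :
    tangentStr u (S u) = liouville M u := hS.second_order u hu

/-- Homogeneity enters here: `Γ S = [C, S] - J[S, S] = S`. -/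
theorem IsSpray.horMap_self (hS : IsSpray S) (hu : u ∈ slit M) : horMap S u (S u) = S u := by
  rw [← hProj_eq_horMap (hS.smoothAt hu).diffAt, hProj_apply, connection_apply, bracket_self,
    map_zero, bracket_congr (hS.J_eventuallyEq hu) (EventuallyEq.refl _ S), hS.homogeneous u hu]
  module

/-- The term `h[S, X]` of `[S, h]X` is horizontal, hence lost under `v`; this leaves `Φ X = v[S, h
X]`. -/
theorem IsSpray.jacobi_eq (hS : IsSpray S) (hu : u ∈ slit M) (hX : X.SmoothAt u) :
    jacobi S X u = bracket S (hProj S X) u - horMap S u (bracket S (hProj S X) u) := by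
  have hs := hS.smoothAt hu
  unfold jacobi
  rw [vProj_eq_horMap (hs.lieH hX).diffAt]
  change (bracket S (hProj S X) u - hProj S (bracket S X) u) -
    horMap S u (bracket S (hProj S X) u - hProj S (bracket S X) u) = _
  rw [hProj_eq_horMap (hs.bracket hX).diffAt, map_sub, hS.horMap_horMap hu]
  abel

theorem IsSpray.tangentStr_jacobi (hS : IsSpray S) (hu : u ∈ slit M) (hX : X.SmoothAt u) :
    tangentStr u (jacobi S X u) = 0 := by
  rw [hS.jacobi_eq hu hX, map_sub, hS.tangentStr_horMap hu, sub_self]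

theorem bracket_zero_right (X : VField M) (u : TB M) : bracket X 0 u = 0 :=
  congrFun (VectorField.mlieBracket_zero_right (I := 𝓘(ℝ, Plane).tangent) (W := X)) u

theorem IsSpray.jacobi_self (hS : IsSpray S) (hu : u ∈ slit M) : jacobi S S u = 0 := by
  have e : hProj S S =ᶠ[𝓝 u] S := by
    filter_upwards [eventually_mem_slit hu] with w hw
    rw [hProj_eq_horMap (hS.smoothAt hw).diffAt, hS.horMap_self hw]
  rw [hS.jacobi_eq hu (hS.smoothAt hu), bracket_congr (EventuallyEq.refl _ S) e, bracket_self,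
    map_zero, sub_zero]

theorem IsSpray.jacobi_J (hS : IsSpray S) (hu : u ∈ slit M) (hX : ∀ᶠ w in 𝓝 u, X.SmoothAt w) :
    jacobi S (J X) u = 0 := by
  have e : hProj S (J X) =ᶠ[𝓝 u] (0 : VField M) := by
    filter_upwards [eventually_mem_slit hu, hX] with w hw hXw
    rw [hProj_eq_horMap hXw.J.diffAt]
    exact hS.horMap_tangentStr hw _
  rw [hS.jacobi_eq hu hX.self_of_nhds.J, bracket_congr (EventuallyEq.refl _ S) e,
    bracket_zero_right, map_zero, sub_zero]

end Spray

variable {S : VField M}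

/-! ### Tensoriality of the Jacobi endomorphism -/

section Tensoriality

/-- An operation on smooth vector fields that is linear over germs of smooth functions at `u`
depends only on the value of the field at `u`. -/
theorem eq_of_tensorial {W : Type*} [AddCommGroup W] [Module ℝ W] {T : VField M → W}
    (hadd : ∀ X Y : VField M, X.SmoothAt u → Y.SmoothAt u → T (X + Y) = T X + T Y)
    (hsmul : ∀ (f : TB M → ℝ) (X : VField M), FunSmoothAt f u → X.SmoothAt u →
      T (f • X) = f u • T X)
    (hloc : ∀ X Y : VField M, X =ᶠ[𝓝 u] Y → T X = T Y)
    (hX : X.SmoothAt u) (hY : Y.SmoothAt u) (h : X u = Y u) : T X = T Y := by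
  classical
  -- In a smooth local frame `s i`, linearity gives `T X = ∑ c i u (X u) • T (s i)`, whose
  -- coefficients depend only on `X u`.
  let t := trivializationAt (Plane × Plane) (fun w : TB M => TTB w) u
  have hu : u ∈ t.baseSet := FiberBundle.mem_baseSet_trivializationAt _ _ u
  let b := Module.Basis.ofVectorSpace ℝ (Plane × Plane)
  let s : _ → VField M := t.localFrame b
  let c := t.localFrameCoeff (𝓘(ℝ, Plane).tangent) b
  have hs : ∀ i, (s i).SmoothAt u := fun i =>
    contMDiffAt_localFrame_of_mem ∞ _ b i hu
  have hc : ∀ {X : VField M}, X.SmoothAt u → ∀ i,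
      FunSmoothAt (fun w => c i w (X w)) u := fun hX i =>
    contMDiffAt_localFrameCoeff b hu hX i
  have h0 : T 0 = 0 := by
    have := hsmul (fun _ => 0) (liouville M) (FunSmoothAt.const 0)
      (smoothAt_liouville u)
    rw [zero_smul] at this
    rw [← this]
    congr 1
    funext w
    exact (zero_smul ℝ _).symm
  have hsum : ∀ (r : Finset (Module.Basis.ofVectorSpaceIndex ℝ (Plane × Plane)))
      (σ : Module.Basis.ofVectorSpaceIndex ℝ (Plane × Plane) → VField M),
      (∀ i ∈ r, (σ i).SmoothAt u) →
      (∑ i ∈ r, σ i).SmoothAt u ∧ T (∑ i ∈ r, σ i) = ∑ i ∈ r, T (σ i) := by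
    intro r σ
    induction r using Finset.induction_on with
    | empty =>
      intro _
      refine ⟨?_, by simpa using h0⟩
      rw [Finset.sum_empty]
      have := (smoothAt_liouville u).const_smul 0
      rwa [zero_smul] at this
    | insert a r ha ih =>
      intro h
      obtain ⟨h1, h2⟩ := ih fun i hi => h i (Finset.mem_insert_of_mem hi)
      rw [Finset.sum_insert ha, Finset.sum_insert ha]
      have h3 := h a (Finset.mem_insert_self _ _)
      exact ⟨h3.add h1, by rw [hadd _ _ h3 h1, h2]⟩
  have key : ∀ {X : VField M}, X.SmoothAt u → T X = ∑ i, c i u (X u) • T (s i) := by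
    intro X hX
    let σ : Module.Basis.ofVectorSpaceIndex ℝ (Plane × Plane) → VField M :=
      fun i => (fun w => c i w (X w)) • s i
    have e : X =ᶠ[𝓝 u] ∑ i, σ i := by
      filter_upwards [t.eventually_eq_localFrame_sum_coeff_smul
        (I := 𝓘(ℝ, Plane).tangent) b hu (s := X)] with w hw
      exact hw.trans (Finset.sum_apply w Finset.univ σ).symm
    refine (hloc _ _ e).trans ((hsum _ σ fun i _ => (hs i).smul (hc hX i)).2.trans ?_)
    exact Finset.sum_congr rfl fun i _ => hsmul _ _ (hc hX i) (hs i)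
  rw [key hX, key hY, h]

theorem hProj_add_eventuallyEq (hX : X.SmoothAt u) (hY : Y.SmoothAt u) :
    hProj S (X + Y) =ᶠ[𝓝 u] hProj S X + hProj S Y := by
  filter_upwards [hX.eventually_diffAt, hY.eventually_diffAt] with w h1 h2
  change _ = hProj S X w + hProj S Y w
  rw [hProj_eq_horMap h1, hProj_eq_horMap h2, hProj_eq_horMap (h1.add h2), ← map_add]
  rfl

theorem hProj_smul_eventuallyEq (hf : FunSmoothAt f u) (hX : X.SmoothAt u) :
    hProj S (f • X) =ᶠ[𝓝 u] f • hProj S X := by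
  filter_upwards [hf.eventually_diffAt, hX.eventually_diffAt] with w h1 h2
  change _ = f w • hProj S X w
  rw [hProj_eq_horMap h2, hProj_eq_horMap (h2.smul h1), ← map_smul]
  rfl

theorem hProj_eventuallyEq_of_eventuallyEq (h : X =ᶠ[𝓝 u] Y) : hProj S X =ᶠ[𝓝 u] hProj S Y :=
  h.eventuallyEq_nhds.mono fun _ hw => hProj_congr hw

theorem lieH_congr (h : X =ᶠ[𝓝 u] Y) : lieH S X u = lieH S Y u := by
  have h1 := bracket_eventuallyEq (EventuallyEq.refl _ S) h
  change bracket S (hProj S X) u - hProj S (bracket S X) u =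
    bracket S (hProj S Y) u - hProj S (bracket S Y) u
  rw [hProj_congr h1, bracket_congr (EventuallyEq.refl _ S) (hProj_eventuallyEq_of_eventuallyEq h)]

theorem jacobi_congr (h : X =ᶠ[𝓝 u] Y) : jacobi S X u = jacobi S Y u := by
  have h1 : lieH S X =ᶠ[𝓝 u] lieH S Y := h.eventuallyEq_nhds.mono fun _ hw => lieH_congr hw
  unfold jacobi
  rw [vProj_apply, vProj_apply, hProj_congr h1, h1.self_of_nhds]

theorem IsSpray.jacobi_add (hS : IsSpray S) (hu : u ∈ slit M) (hX : X.SmoothAt u)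
    (hY : Y.SmoothAt u) : jacobi S (X + Y) u = jacobi S X u + jacobi S Y u := by
  have hs := hS.smoothAt hu
  rw [hS.jacobi_eq hu (hX.add hY), hS.jacobi_eq hu hX, hS.jacobi_eq hu hY,
    bracket_congr (EventuallyEq.refl _ S) (hProj_add_eventuallyEq hX hY),
    bracket_add_right (hs.hProj hX).diffAt (hs.hProj hY).diffAt, map_add]
  abel

theorem IsSpray.jacobi_smul (hS : IsSpray S) (hu : u ∈ slit M) (hf : FunSmoothAt f u)
    (hX : X.SmoothAt u) : jacobi S (f • X) u = f u • jacobi S X u := by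
  have hs := hS.smoothAt hu
  rw [hS.jacobi_eq hu (hX.smul hf), hS.jacobi_eq hu hX,
    bracket_congr (EventuallyEq.refl _ S) (hProj_smul_eventuallyEq hf hX),
    bracket_smul_right hf.diffAt (hs.hProj hX).diffAt, map_add, map_smul, map_smul,
    hProj_eq_horMap hX.diffAt, hS.horMap_horMap hu]
  module

/-- Second derivatives of the field appear in `Φ`, so tensoriality is taken over smooth germs rather
than over fields merely differentiable at `u`, as was enough for `h`. -/
theorem IsSpray.jacobi_eq_of_eq (hS : IsSpray S) (hu : u ∈ slit M) (hX : X.SmoothAt u)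
    (hY : Y.SmoothAt u) (h : X u = Y u) : jacobi S X u = jacobi S Y u :=
  eq_of_tensorial (T := fun X => jacobi S X u) (fun _ _ h1 h2 => hS.jacobi_add hu h1 h2)
    (fun _ _ h1 h2 => hS.jacobi_smul hu h1 h2) (fun _ _ h => jacobi_congr h) hX hY h

end Tensoriality

/-! ### Calculus along the fibres -/

section Fibre

theorem projDeriv_apply_eq (ξ : TTB u) (i : Fin 2) :
    projDeriv u ξ i = differential (xCoord u.1 i) u ξ := by
  have h : coordMap u.1 u.1 = ContinuousLinearMap.id ℝ Plane :=
    (TangentBundle.continuousLinearMapAt_trivializationAt (mem_chart_source Plane u.1)).trans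
      mfderiv_extChartAt_self
  rw [differential_xCoord (mem_chart_source Plane u.1), h]
  rfl

theorem differentiableAt_comp_toTB (hf : FunDiffAt f u) :
    DifferentiableAt ℝ (f ∘ toTB u.1) (vec u) :=
  mdifferentiableAt_iff_differentiableAt.1 (MDifferentiableAt.comp (vec u) (f := toTB u.1) hf
    ((contMDiff_toTB u.1).contMDiffAt.mdifferentiableAt (by simp)))

theorem differential_verticalLift (hf : FunDiffAt f u) (a : Plane) :
    differential f u (verticalLift u a) = fderiv ℝ (f ∘ toTB u.1) (vec u) a := by
  have h := mfderiv_comp (vec u) (f := toTB u.1) (g := f) hf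
    ((contMDiff_toTB u.1).contMDiffAt.mdifferentiableAt (by simp))
  rw [mfderiv_eq_fderiv] at h
  exact (congrArg (fun l => l a) h).symm

/-- The projection of a vector field to `M`, along the fibre over `p`. -/
noncomputable def fibreProj (Y : VField M) (p : M) (a : Plane) : Plane :=
  projDeriv (toTB p a) (Y (toTB p a))

theorem fibreProj_apply (Y : VField M) (p : M) (i : Fin 2) :
    (fun a => fibreProj Y p a i) = dirDeriv Y (xCoord p i) ∘ toTB p :=
  funext fun a => projDeriv_apply_eq (u := toTB p a) _ i

theorem differentiableAt_fibreProj (hY : Y.SmoothAt u) :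
    DifferentiableAt ℝ (fibreProj Y u.1) (vec u) := by
  rw [differentiableAt_euclidean]
  intro i
  rw [fibreProj_apply]
  exact differentiableAt_comp_toTB
    ((smoothAt_xCoord (mem_chart_source Plane u.1) i).dirDeriv hY).diffAt

/-- By `bracket_J_xCoord` the projection of `[J X, Y]` has components `J X(Y(xⁱ))`, and a vertical
derivative is an ordinary derivative in the fibre. This turns brackets with vertical fields into
calculus on the plane. -/
theorem fderiv_fibreProj (hX : X.SmoothAt u) (hY : Y.SmoothAt u) :
    fderiv ℝ (fibreProj Y u.1) (vec u) (projDeriv u (X u)) =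
      projDeriv u (bracket (J X) Y u) := by
  have hs := mem_chart_source Plane u.1
  ext i
  rw [projDeriv_apply_eq]
  change _ = dirDeriv (bracket (J X) Y) (xCoord u.1 i) u
  rw [bracket_J_xCoord hX hY]
  change _ = differential _ u (verticalLift u (projDeriv u (X u)))
  rw [differential_verticalLift ((smoothAt_xCoord hs i).dirDeriv hY).diffAt, ← fibreProj_apply]
  have h := ((EuclideanSpace.proj (𝕜 := ℝ) i : Plane →L[ℝ] ℝ).hasFDerivAt.comp (vec u)
    (differentiableAt_fibreProj hY).hasFDerivAt).fderiv
  exact (congrArg (fun l => l (projDeriv u (X u))) h).symm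

/-- The square of a Finsler function. -/
def energy (F : TB M → ℝ) : TB M → ℝ := fun w => F w ^ 2

variable {F : TB M → ℝ}

theorem IsFinsler.smoothAt_energy (hF : IsFinsler F) (hu : u ∈ slit M) :
    FunSmoothAt (energy F) u :=
  ContMDiffAt.pow (hF.smooth u hu) 2

theorem IsFinsler.energy_pos (hF : IsFinsler F) (hu : u ∈ slit M) : 0 < energy F u :=
  pow_pos (hF.pos u hu) 2

theorem IsFinsler.contDiffAt_fibreSq (hF : IsFinsler F) (hu : u ∈ slit M) :
    ContDiffAt ℝ ∞ (fibreSq F u.1) (vec u) :=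
  contMDiffAt_iff_contDiffAt.1 (ContMDiffAt.comp (vec u) (f := toTB u.1) (hF.smoothAt_energy hu)
    (contMDiff_toTB u.1).contMDiffAt)

theorem IsFinsler.differential_verticalLift (hF : IsFinsler F) (hu : u ∈ slit M) (a : Plane) :
    differential (energy F) u (verticalLift u a) = fderiv ℝ (fibreSq F u.1) (vec u) a :=
  BerwaldFrame.differential_verticalLift (hF.smoothAt_energy hu).diffAt a

theorem IsFinsler.differential_tangentStr (hF : IsFinsler F) (hu : u ∈ slit M) (ξ : TTB u) :
    differential (energy F) u (tangentStr u ξ) =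
      fderiv ℝ (fibreSq F u.1) (vec u) (projDeriv u ξ) :=
  hF.differential_verticalLift hu _

/-- Euler's identity: differentiate `F²(c y) = c² F²(y)` at `c = 1`. -/
theorem IsFinsler.dirDeriv_liouville (hF : IsFinsler F) (hu : u ∈ slit M) :
    dirDeriv (liouville M) (energy F) u = 2 * energy F u := by
  refine (hF.differential_verticalLift hu (vec u)).trans ?_
  have h1 : HasDerivAt (fun c : ℝ => fibreSq F u.1 (c • vec u))
      (fderiv ℝ (fibreSq F u.1) (vec u) (vec u)) 1 := by
    have h2 : HasFDerivAt (fibreSq F u.1) (fderiv ℝ (fibreSq F u.1) (vec u)) ((1 : ℝ) • vec u) := by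
      rw [one_smul]
      exact ((hF.contDiffAt_fibreSq hu).differentiableAt (by simp)).hasFDerivAt
    have h3 : HasDerivAt (fun c : ℝ => c • vec u) (vec u) 1 := by
      simpa using (hasDerivAt_id (1 : ℝ)).smul_const (vec u)
    exact h2.comp_hasDerivAt 1 h3
  have h4 : (fun c : ℝ => fibreSq F u.1 (c • vec u)) =ᶠ[𝓝 1] fun c => c ^ 2 * energy F u := by
    filter_upwards [lt_mem_nhds (zero_lt_one (α := ℝ))] with c hc
    unfold fibreSq energy
    rw [hF.homogeneous u c hc.le]
    ring
  have h5 : HasDerivAt (fun c : ℝ => c ^ 2 * energy F u) (2 * energy F u) 1 := by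
    simpa using (hasDerivAt_pow 2 (1 : ℝ)).mul_const (energy F u)
  exact (h1.congr_of_eventuallyEq h4.symm).unique h5

theorem extD_dJSq (F : TB M → ℝ) (X Y : VField M) (u : TB M) :
    extD (dJSq F) X Y u = dirDeriv X (dirDeriv (J Y) (energy F)) u -
      dirDeriv Y (dirDeriv (J X) (energy F)) u - dirDeriv (J (bracket X Y)) (energy F) u := rfl

theorem metricTensor_eq (F : TB M → ℝ) (u : TB M) (a b : Plane) :
    metricTensor F u a b = (1 / 2) * fderiv ℝ (fderiv ℝ (fibreSq F u.1)) (vec u) a b := by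
  unfold metricTensor
  rw [iteratedFDeriv_two_apply]
  simp

theorem eventually_toTB_mem_slit (hu : u ∈ slit M) : ∀ᶠ a in 𝓝 (vec u), toTB u.1 a ∈ slit M :=
  isOpen_ne.mem_nhds hu

theorem IsFinsler.dirDeriv_J_comp_toTB (hF : IsFinsler F) (hu : u ∈ slit M) (Y : VField M) :
    dirDeriv (J Y) (energy F) ∘ toTB u.1 =ᶠ[𝓝 (vec u)]
      fun a => fderiv ℝ (fibreSq F u.1) a (fibreProj Y u.1 a) := by
  filter_upwards [eventually_toTB_mem_slit hu] with a ha
  exact hF.differential_tangentStr ha _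

theorem IsFinsler.differentiableAt_fderiv (hF : IsFinsler F) (hu : u ∈ slit M) :
    DifferentiableAt ℝ (fderiv ℝ (fibreSq F u.1)) (vec u) :=
  ((hF.contDiffAt_fibreSq hu).fderiv_right (m := ∞) (by simp)).differentiableAt (by simp)

/-- `dd_J F² (J X, Y) = 2 g(π_* X, π_* Y)`. -/
theorem IsFinsler.extD_J (hF : IsFinsler F) (hu : u ∈ slit M) (hX : X.SmoothAt u)
    (hY : Y.SmoothAt u) :
    extD (dJSq F) (J X) Y u = 2 * metricTensor F u (projDeriv u (X u)) (projDeriv u (Y u)) := by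
  have hE := hF.smoothAt_energy hu
  rw [extD_dJSq, metricTensor_eq, J_J]
  have h0 : dirDeriv Y (dirDeriv (0 : VField M) (energy F)) u = 0 :=
    dirDeriv_eq_zero_of_eventually
      (Eventually.of_forall fun w => (differential (energy F) w).map_zero)
  -- Along the fibre `J Y(F²)` is `D(F²)` applied to the projection of `Y`. The product rule gives
  -- the Hessian term and a term in `π_*[J X, Y]`, which the bracket term of `extD` cancels.
  have h1 : dirDeriv (J X) (dirDeriv (J Y) (energy F)) u =
      fderiv ℝ (fibreSq F u.1) (vec u) (projDeriv u (bracket (J X) Y u)) +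
      fderiv ℝ (fderiv ℝ (fibreSq F u.1)) (vec u) (projDeriv u (X u)) (projDeriv u (Y u)) := by
    refine (BerwaldFrame.differential_verticalLift (hE.dirDeriv hY.J).diffAt _).trans ?_
    rw [(hF.dirDeriv_J_comp_toTB hu Y).fderiv_eq,
      fderiv_clm_apply (hF.differentiableAt_fderiv hu) (differentiableAt_fibreProj hY),
      ← fderiv_fibreProj hX hY]
    rfl
  have h2 : dirDeriv (J (bracket (J X) Y)) (energy F) u =
      fderiv ℝ (fibreSq F u.1) (vec u) (projDeriv u (bracket (J X) Y u)) :=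
    hF.differential_tangentStr hu _
  rw [h0, h1, h2]
  ring

theorem IsFinsler.metricTensor_symm (hF : IsFinsler F) (hu : u ∈ slit M) (a b : Plane) :
    metricTensor F u a b = metricTensor F u b a := by
  have h : IsSymmSndFDerivAt ℝ (fibreSq F u.1) (vec u) :=
    (hF.contDiffAt_fibreSq hu).isSymmSndFDerivAt
      (by simp only [minSmoothness_of_isRCLikeNormedField]; exact WithTop.coe_le_coe.2 le_top)
  rw [metricTensor_eq, metricTensor_eq, h.eq]

end Fibre

/-! ### The geodesic spray -/

section Geodesic

variable {F : TB M → ℝ}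

theorem IsFinsler.dirDeriv_J_spray (hF : IsFinsler F) (hS : IsSpray S) (hu : u ∈ slit M) :
    dirDeriv (J S) (energy F) =ᶠ[𝓝 u] fun w => 2 * energy F w := by
  filter_upwards [eventually_mem_slit hu] with w hw
  rw [← hF.dirDeriv_liouville hw]
  change differential _ w (tangentStr w (S w)) = _
  rw [hS.tangentStr_self hw]
  rfl

/-- Conservation of energy: insert `S` itself in the geodesic equation, whose left side is
alternating. -/
theorem IsGeodesicSpray.dirDeriv_self (hS : IsGeodesicSpray F S) (hu : u ∈ slit M) :
    dirDeriv S (energy F) u = 0 := by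
  have h := hS.2 u hu S (hS.1.smoothAt hu)
  rw [extD_dJSq] at h
  have h1 : dirDeriv (J (bracket S S)) (energy F) u = 0 := by
    change differential _ u (tangentStr u (bracket S S u)) = 0
    rw [bracket_self, map_zero, map_zero]
  rw [h1, sub_self, sub_zero] at h
  exact neg_eq_zero.1 h.symm

theorem IsGeodesicSpray.dirDeriv_self_eventuallyEq (hS : IsGeodesicSpray F S) (hu : u ∈ slit M) :
    ∀ᶠ w in 𝓝 u, dirDeriv S (energy F) w = 0 :=
  (eventually_mem_slit hu).mono fun _ hw => hS.dirDeriv_self hw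

/-- The Euler–Lagrange equations of the energy. -/
theorem IsGeodesicSpray.euler_lagrange (hF : IsFinsler F) (hS : IsGeodesicSpray F S)
    (hu : u ∈ slit M) (hX : X.SmoothAt u) :
    dirDeriv S (dirDeriv (J X) (energy F)) u - dirDeriv (J (bracket S X)) (energy F) u =
      dirDeriv X (energy F) u := by
  have h := hS.2 u hu X hX
  rw [extD_dJSq, dirDeriv_congr (hF.dirDeriv_J_spray hS.1 hu),
    dirDeriv_const_mul 2 (hF.smoothAt_energy hu).diffAt] at h
  change _ = - dirDeriv X (energy F) u at h
  linarith

/-- Because `S(F²) = 0`, the bracket `[J X, S]` acts on the energy as `-S(J X(F²))`. Twice the left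
side is then the difference of the two sides of the Euler–Lagrange equation. -/
theorem IsGeodesicSpray.dirDeriv_hProj (hF : IsFinsler F) (hS : IsGeodesicSpray F S)
    (hu : u ∈ slit M) (hX : X.SmoothAt u) : dirDeriv (hProj S X) (energy F) u = 0 := by
  have hE := hF.smoothAt_energy hu
  have h1 := hS.euler_lagrange hF hu hX
  have h2 := dirDeriv_bracket hX.J (hS.1.smoothAt hu) hE
  rw [dirDeriv_eq_zero_of_eventually (hS.dirDeriv_self_eventuallyEq hu)] at h2
  have h3 : dirDeriv (J (bracket X S)) (energy F) u =
      - dirDeriv (J (bracket S X)) (energy F) u := by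
    change differential _ u (tangentStr u (bracket X S u)) =
      - differential _ u (tangentStr u (bracket S X u))
    rw [bracket_swap, map_neg, map_neg]
  have h4 : dirDeriv (hProj S X) (energy F) u = (1 / 2) * (dirDeriv X (energy F) u +
      (dirDeriv (bracket (J X) S) (energy F) u - dirDeriv (J (bracket X S)) (energy F) u)) := by
    unfold dirDeriv
    rw [hProj_apply, map_smul, map_add, connection_apply, map_sub]
    rfl
  rw [h4, h2, h3]
  linarith

theorem IsGeodesicSpray.differential_horMap (hF : IsFinsler F) (hS : IsGeodesicSpray F S)
    (hu : u ∈ slit M) (ξ : TTB u) : differential (energy F) u (horMap S u ξ) = 0 := by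
  obtain ⟨X, rfl, hX⟩ := exists_extension ξ
  have hX := hX.self_of_nhds
  rw [← hProj_eq_horMap hX.diffAt]
  exact hS.dirDeriv_hProj hF hu hX

/-- Up to a horizontal vector `Φ X` is `[S, h X]`, and both `S` and `h X` annihilate the energy near
`u`. -/
theorem IsGeodesicSpray.differential_jacobi (hF : IsFinsler F) (hS : IsGeodesicSpray F S)
    (hu : u ∈ slit M) (hX : ∀ᶠ w in 𝓝 u, X.SmoothAt w) :
    differential (energy F) u (jacobi S X u) = 0 := by
  have hs := hS.1.smoothAt hu
  have hX' := hX.self_of_nhds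
  rw [hS.1.jacobi_eq hu hX', map_sub, hS.differential_horMap hF hu, sub_zero]
  change dirDeriv (bracket S (hProj S X)) (energy F) u = 0
  rw [dirDeriv_bracket hs (hs.hProj hX') (hF.smoothAt_energy hu),
    dirDeriv_eq_zero_of_eventually (hS.dirDeriv_self_eventuallyEq hu), sub_zero]
  refine dirDeriv_eq_zero_of_eventually ?_
  filter_upwards [hX, eventually_mem_slit hu] with w h1 h2
  exact hS.dirDeriv_hProj hF h2 h1

theorem IsSpray.J_vProj (hS : IsSpray S) (hu : u ∈ slit M) (hX : X.DiffAt u) :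
    J (vProj S X) u = 0 := by
  change tangentStr u (vProj S X u) = 0
  rw [vProj_eq_horMap hX, map_sub, hS.tangentStr_horMap hu, sub_self]

/-- From `J h = J` the left side is `-J[S, v X]`, and `v X` is vertical, so `IsSpray.J_bracket`
applies. It follows that `J 𝔽 = v`. -/
theorem IsSpray.tangentStr_lieH (hS : IsSpray S) (hu : u ∈ slit M) (hX : X.SmoothAt u) :
    tangentStr u (lieH S X u) = vProj S X u := by
  have hs := hS.smoothAt hu
  have h1 : ∀ᶠ w in 𝓝 u, J (vProj S X) w = 0 := by
    filter_upwards [hX.eventually_diffAt, eventually_mem_slit hu] with w h1 h2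
    exact hS.J_vProj h2 h1
  have h2 := hS.J_bracket hu (hs.vProj hX) h1
  have h3 : vProj S X = X - hProj S X := funext fun w => vProj_apply S X w
  have h4 : J (bracket S (vProj S X)) u =
      tangentStr u (bracket S X u) - tangentStr u (bracket S (hProj S X) u) := by
    rw [h3, ← map_sub, ← bracket_sub_right hX.diffAt (hs.hProj hX).diffAt]
    rfl
  change tangentStr u (bracket S (hProj S X) u - hProj S (bracket S X) u) = _
  rw [map_sub, hProj_eq_horMap (hs.bracket hX).diffAt, hS.tangentStr_horMap hu]
  rw [h2] at h4
  rw [← neg_sub, ← h4, neg_neg]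

theorem IsSpray.tangentStr_almostComplex (hS : IsSpray S) (hu : u ∈ slit M) (hX : X.SmoothAt u) :
    tangentStr u (almostComplex S X u) = vProj S X u := by
  have hs := hS.smoothAt hu
  change tangentStr u (hProj S (lieH S X) u - tangentStr u (X u)) = _
  rw [map_sub, tangentStr_tangentStr, sub_zero, hProj_eq_horMap (hs.lieH hX).diffAt,
    hS.tangentStr_horMap hu, hS.tangentStr_lieH hu hX]

/-- Use `J 𝔽 = v` and the vanishing of `dF²` on horizontal vectors. This evaluates `i_𝔽(α/ρ)` in
`Ω`. -/
theorem IsGeodesicSpray.differential_almostComplex (hF : IsFinsler F) (hS : IsGeodesicSpray F S)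
    (hu : u ∈ slit M) (hX : X.SmoothAt u) :
    dJSq F u (almostComplex S X u) = dirDeriv X (energy F) u := by
  change differential (energy F) u (tangentStr u _) = _
  rw [hS.1.tangentStr_almostComplex hu hX, vProj_eq_horMap hX.diffAt, map_sub,
    hS.differential_horMap hF hu, sub_zero]
  rfl

end Geodesic

/-! ### Vertical vectors in the kernel of `dF²` -/

section Kernel

variable {F : TB M → ℝ}

theorem exists_eq_smul_of_apply_eq_zero {l : Plane →L[ℝ] ℝ} (hl : l ≠ 0) {a b : Plane}
    (ha : a ≠ 0) (hla : l a = 0) (hlb : l b = 0) : ∃ c : ℝ, b = c • a := by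
  have h2 : Module.finrank ℝ (LinearMap.ker (l : Plane →ₗ[ℝ] ℝ)) = 1 := by
    have h3 : (l : Plane →ₗ[ℝ] ℝ) ≠ 0 := fun h => hl (ContinuousLinearMap.coe_injective h)
    have h4 := (l : Plane →ₗ[ℝ] ℝ).finrank_range_add_finrank_ker
    rw [LinearMap.range_eq_top.2 (LinearMap.surjective h3), finrank_top, Module.finrank_self,
      finrank_euclideanSpace_fin] at h4
    omega
  obtain ⟨c, hc⟩ := (finrank_eq_one_iff_of_nonzero'
    (⟨a, hla⟩ : LinearMap.ker (l : Plane →ₗ[ℝ] ℝ))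
    (fun h => ha (congrArg Subtype.val h))).1 h2 ⟨b, hlb⟩
  exact ⟨c, (congrArg Subtype.val hc).symm⟩

theorem exists_ne_zero_apply_eq_zero (l : Plane →L[ℝ] ℝ) : ∃ a : Plane, a ≠ 0 ∧ l a = 0 := by
  have h : LinearMap.ker (l : Plane →ₗ[ℝ] ℝ) ≠ ⊥ := by
    apply LinearMap.ker_ne_bot_of_finrank_lt
    rw [finrank_euclideanSpace_fin, Module.finrank_self]
    norm_num
  obtain ⟨a, ha, h0⟩ := (Submodule.ne_bot_iff _).1 h
  exact ⟨a, h0, ha⟩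

theorem IsFinsler.fderiv_fibreSq_ne_zero (hF : IsFinsler F) (hu : u ∈ slit M) :
    fderiv ℝ (fibreSq F u.1) (vec u) ≠ 0 := by
  intro h
  have h1 := hF.dirDeriv_liouville hu
  change differential (energy F) u (verticalLift u (vec u)) = _ at h1
  rw [hF.differential_verticalLift hu, h] at h1
  have := hF.energy_pos hu
  change (0 : ℝ) = _ at h1
  linarith

/-- Here dimension two is decisive: `dF²` is nonzero on the vertical plane by Euler's identity, so
its kernel there is a line. -/
theorem IsFinsler.exists_eq_smul (hF : IsFinsler F) (hu : u ∈ slit M) {ζ ξ : TTB u}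
    (hζ : tangentStr u ζ = 0) (hξ : tangentStr u ξ = 0) (h0 : ζ ≠ 0)
    (h1 : differential (energy F) u ζ = 0) (h2 : differential (energy F) u ξ = 0) :
    ∃ c : ℝ, ξ = c • ζ := by
  obtain ⟨a, rfl⟩ := exists_verticalLift hζ
  obtain ⟨b, rfl⟩ := exists_verticalLift hξ
  rw [hF.differential_verticalLift hu] at h1 h2
  obtain ⟨c, rfl⟩ := exists_eq_smul_of_apply_eq_zero (hF.fderiv_fibreSq_ne_zero hu)
    (fun h => h0 (by rw [h, map_zero])) h1 h2
  exact ⟨c, map_smul _ _ _⟩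

/-- Locally there is a smooth field `X` such that `J X` is nonzero and tangent at `u` to the level
set of the Finsler function. -/
theorem IsFinsler.exists_field (hF : IsFinsler F) (hu : u ∈ slit M) :
    ∃ X : VField M, (∀ᶠ w in 𝓝 u, X.SmoothAt w) ∧ projDeriv u (X u) ≠ 0 ∧
      differential (energy F) u (J X u) = 0 := by
  obtain ⟨a, ha, hla⟩ := exists_ne_zero_apply_eq_zero (fderiv ℝ (fibreSq F u.1) (vec u))
  obtain ⟨ξ, rfl⟩ := projDeriv_surjective u a
  obtain ⟨X, rfl, hX⟩ := exists_extension ξ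
  exact ⟨X, hX, ha, (hF.differential_tangentStr hu _).trans hla⟩

end Kernel

/-! ### Isotropy -/

section Isotropy

variable {F : TB M → ℝ}

/-- Modulo vertical vectors every `X` is `t S + c X₀`, where `J X₀` spans the vertical kernel of
`dF²`. Since `Φ` kills `S` and vertical vectors and takes values in that kernel, `Φ X₀ = r J X₀`
determines it. -/
theorem IsGeodesicSpray.exists_jacobi_eq (hF : IsFinsler F) (hS : IsGeodesicSpray F S)
    (hu : u ∈ slit M) : ∃ r : ℝ, ∀ X : VField M, X.SmoothAt u → jacobi S X u =
      r • (J X u - (dirDeriv (J X) (energy F) u / (2 * energy F u)) • liouville M u) := by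
  obtain ⟨X₀, hX₀, h0, h1⟩ := hF.exists_field hu
  have hX₀' := hX₀.self_of_nhds
  have hne : J X₀ u ≠ 0 := fun h => h0 (tangentStr_eq_zero_iff.1 h)
  have hE := hF.energy_pos hu
  obtain ⟨r, hr⟩ := hF.exists_eq_smul hu (tangentStr_tangentStr (X₀ u))
    (hS.1.tangentStr_jacobi hu hX₀') hne h1 (hS.differential_jacobi hF hu hX₀)
  refine ⟨r, fun X hX => ?_⟩
  -- By Euler's identity this `t` makes `J X - t C` annihilate the energy, so that it is a multiple
  -- `c` of `J X₀`.
  set t := dirDeriv (J X) (energy F) u / (2 * energy F u) with ht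
  have h2 : differential (energy F) u (J X u - t • liouville M u) = 0 := by
    rw [map_sub, map_smul]
    change dirDeriv (J X) (energy F) u - t * dirDeriv (liouville M) (energy F) u = 0
    rw [hF.dirDeriv_liouville hu, ht]
    field_simp
    ring
  have h3 : tangentStr u (J X u - t • liouville M u) = 0 := by
    rw [map_sub, map_smul, tangentStr_liouville, smul_zero, sub_zero]
    exact tangentStr_tangentStr _
  obtain ⟨c, hc⟩ := hF.exists_eq_smul hu (tangentStr_tangentStr (X₀ u)) h3 hne h1 h2
  have h4 : tangentStr u (X u - (t • S u + c • X₀ u)) = 0 := by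
    rw [map_sub, map_add, map_smul, map_smul, hS.1.tangentStr_self hu, ← sub_sub]
    exact sub_eq_zero.2 hc
  obtain ⟨ζ, hζ⟩ := exists_tangentStr h4
  obtain ⟨Z, rfl, hZ⟩ := exists_extension ζ
  have hs := hS.1.smoothAt hu
  have h5 : X u = ((fun _ : TB M => t) • S + (fun _ : TB M => c) • X₀ + J Z) u := by
    change X u = t • S u + c • X₀ u + tangentStr u (Z u)
    rw [← hζ]
    abel
  have s1 := hs.smul (FunSmoothAt.const t)
  have s2 := hX₀'.smul (FunSmoothAt.const c)
  rw [hS.1.jacobi_eq_of_eq hu hX ((s1.add s2).add hZ.self_of_nhds.J) h5,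
    hS.1.jacobi_add hu (s1.add s2) hZ.self_of_nhds.J, hS.1.jacobi_add hu s1 s2,
    hS.1.jacobi_smul hu (FunSmoothAt.const t) hs, hS.1.jacobi_smul hu (FunSmoothAt.const c) hX₀',
    hS.1.jacobi_self hu, hS.1.jacobi_J hu hZ, smul_zero, zero_add, add_zero, hr, hc]
  exact smul_comm _ _ _

/-- Near `u` one has `Φ X = ρ N` with `N = J X - k C` smooth and nonzero at `u`. Some fibre
coordinate then satisfies `N(yⁱ) ≠ 0`, and `ρ` is the quotient `(Φ X)(yⁱ) / N(yⁱ)`. -/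
theorem IsGeodesicSpray.smoothAt_of_jacobi_eq (hF : IsFinsler F) (hS : IsGeodesicSpray F S)
    {ρ : TB M → ℝ} (hρ : ∀ w ∈ slit M, ∀ X : VField M, X.SmoothAt w → jacobi S X w =
      ρ w • (J X w - (dirDeriv (J X) (energy F) w / (2 * energy F w)) • liouville M w))
    (hu : u ∈ slit M) : FunSmoothAt ρ u := by
  obtain ⟨X, hX, h0, h1⟩ := hF.exists_field hu
  have hX' := hX.self_of_nhds
  have hE := hF.smoothAt_energy hu
  have hE0 : 2 * energy F u ≠ 0 := (mul_pos two_pos (hF.energy_pos hu)).ne'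
  have hsrc := mem_chart_source Plane u.1
  let k : TB M → ℝ := fun w => dirDeriv (J X) (energy F) w / (2 * energy F w)
  have hk : FunSmoothAt k u :=
    (hE.dirDeriv hX'.J).div ((FunSmoothAt.const 2).mul hE) hE0
  let N : VField M := J X - k • liouville M
  have hN : N.SmoothAt u := hX'.J.sub ((smoothAt_liouville u).smul hk)
  have hk0 : k u = 0 := by
    change dirDeriv (J X) (energy F) u / _ = 0
    rw [show dirDeriv (J X) (energy F) u = 0 from h1, zero_div]
  have hNu : N u = verticalLift u (projDeriv u (X u)) := by
    change tangentStr u (X u) - k u • liouville M u = _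
    rw [hk0, zero_smul, sub_zero]
    rfl
  have h2 : coordMap u.1 u.1 (projDeriv u (X u)) ≠ 0 := fun h =>
    h0 (coordMap_injective hsrc (h.trans (map_zero _).symm))
  obtain ⟨i, hi⟩ : ∃ i, coordMap u.1 u.1 (projDeriv u (X u)) i ≠ 0 := by
    by_contra! h
    exact h2 (by ext i; exact h i)
  have h3 : dirDeriv N (yCoord u.1 i) u ≠ 0 := by
    change differential _ u (N u) ≠ 0
    rw [hNu, differential_yCoord_verticalLift hsrc]
    exact hi
  have sN := (smoothAt_yCoord hsrc i).dirDeriv hN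
  refine (((smoothAt_yCoord hsrc i).dirDeriv ((hS.1.smoothAt hu).jacobi hX')).div sN h3).congr ?_
  filter_upwards [hX, eventually_mem_slit hu, sN.continuousAt.eventually_ne h3] with w hw1 hw2 hw3
  rw [eq_div_iff hw3]
  change _ = differential _ w (jacobi S X w)
  rw [hρ w hw2 X hw1, map_smul]
  rfl

theorem IsGeodesicSpray.exists_isIsotropicPair (hF : IsFinsler F) (hS : IsGeodesicSpray F S) :
    ∃ (ρ : TB M → ℝ) (α : OneForm M), IsIsotropicPair S ρ α := by
  have h : ∀ w : TB M, ∃ r : ℝ, w ∈ slit M → ∀ X : VField M, X.SmoothAt w → jacobi S X w =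
      r • (J X w - (dirDeriv (J X) (energy F) w / (2 * energy F w)) • liouville M w) := by
    intro w
    by_cases hw : w ∈ slit M
    · obtain ⟨r, hr⟩ := hS.exists_jacobi_eq hF hw
      exact ⟨r, fun _ => hr⟩
    · exact ⟨0, fun h => absurd h hw⟩
  choose ρ hρ using h
  have hsm : FunSmooth ρ := fun u hu => hS.smoothAt_of_jacobi_eq hF hρ hu
  refine ⟨ρ, fun w => (ρ w / (2 * energy F w)) • dJSq F w, hsm, fun u hu X hX => ?_,
    fun u hu ξ => ?_, fun u hu X hX => ?_⟩
  · have hE := hF.smoothAt_energy hu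
    exact ((hsm u hu).div ((FunSmoothAt.const 2).mul hE)
      (mul_pos two_pos (hF.energy_pos hu)).ne').mul (hE.dirDeriv hX.J)
  · change _ * differential (energy F) u (tangentStr u (tangentStr u ξ)) = 0
    rw [tangentStr_tangentStr, map_zero, mul_zero]
  · rw [hρ u hu X hX, smul_sub, smul_smul]
    change _ = _ - (ρ u / (2 * energy F u) * dirDeriv (J X) (energy F) u) • liouville M u
    rw [mul_div_assoc', div_mul_eq_mul_div]

/-- Apply `dF²` to `Φ X = ρ J X - α(X) C`: the left side vanishes and `C(F²) = 2F²`. -/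
theorem IsIsotropicPair.form_eq {ρ : TB M → ℝ} {α : OneForm M} (h : IsIsotropicPair S ρ α)
    (hF : IsFinsler F) (hS : IsGeodesicSpray F S) (hu : u ∈ slit M) (ξ : TTB u) :
    2 * energy F u * α u ξ = ρ u * dJSq F u ξ := by
  obtain ⟨X, rfl, hX⟩ := exists_extension ξ
  have h1 := hS.differential_jacobi hF hu hX
  rw [h.eq u hu X hX.self_of_nhds, map_sub, map_smul, map_smul] at h1
  change ρ u * dJSq F u (X u) - α u (X u) * dirDeriv (liouville M) (energy F) u = 0 at h1
  rw [hF.dirDeriv_liouville hu] at h1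
  linarith

theorem IsIsotropicPair.ne_zero {ρ : TB M → ℝ} {α : OneForm M} (h : IsIsotropicPair S ρ α)
    (hF : IsFinsler F) (hS : IsGeodesicSpray F S) (hflat : NonFlat S) (hu : u ∈ slit M) :
    ρ u ≠ 0 := by
  intro h0
  obtain ⟨X, hX, hne⟩ := hflat u hu
  have h1 := h.form_eq hF hS hu (X u)
  rw [h0, zero_mul] at h1
  have h2 := (mul_eq_zero.1 h1).resolve_left (mul_pos two_pos (hF.energy_pos hu)).ne'
  apply hne
  rw [h.eq u hu X hX, h0, h2, zero_smul, zero_smul, sub_zero]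

end Isotropy

/-! ### Regularity -/

section Regularity

variable {F : TB M → ℝ}

theorem extD_congr {β β' : OneForm M} (h : ∀ᶠ w in 𝓝 u, β w = β' w) :
    extD β X Y u = extD β' X Y u := by
  have h1 : ∀ Z : VField M, (fun w => β w (Z w)) =ᶠ[𝓝 u] fun w => β' w (Z w) := fun Z =>
    h.mono fun w hw =>
    congrArg (fun l => l (Z w)) hw
  unfold extD
  rw [dirDeriv_congr (h1 Y), dirDeriv_congr (h1 X), h.self_of_nhds]

theorem extD_swap (β : OneForm M) (X Y : VField M) (u : TB M) :
    extD β X Y u = - extD β Y X u := by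
  unfold extD
  rw [bracket_swap, map_neg]
  ring

theorem extD_smul {β : OneForm M} (hf : FunDiffAt f u) (hX : FunDiffAt (fun w => β w (X w)) u)
    (hY : FunDiffAt (fun w => β w (Y w)) u) :
    extD (fun w => f w • β w) X Y u = f u * extD β X Y u + dirDeriv X f u * β u (Y u) -
      dirDeriv Y f u * β u (X u) := by
  change dirDeriv X (fun w => f w * β w (Y w)) u - dirDeriv Y (fun w => f w * β w (X w)) u -
    f u * β u (bracket X Y u) = _
  rw [dirDeriv_mul hf hY, dirDeriv_mul hf hX]
  unfold extD
  ring

theorem extD_add_left {β : OneForm M} (hX : X.SmoothAt u) (hY : Y.SmoothAt u)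
    (h1 : FunDiffAt (fun w => β w (X w)) u) (h2 : FunDiffAt (fun w => β w (Y w)) u) :
    extD β (X + Y) Z u = extD β X Z u + extD β Y Z u := by
  have h3 : (fun w => β w ((X + Y) w)) = fun w => β w (X w) + β w (Y w) :=
    funext fun w => map_add _ _ _
  unfold extD
  rw [h3, dirDeriv_add h1 h2, bracket_add_left hX.diffAt hY.diffAt, map_add, dirDeriv_add_left]
  ring

theorem extD_smul_left {β : OneForm M} (hf : FunSmoothAt f u) (hX : X.SmoothAt u)
    (h1 : FunDiffAt (fun w => β w (X w)) u) :
    extD β (f • X) Z u = f u * extD β X Z u := by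
  have h3 : (fun w => β w ((f • X) w)) = fun w => f w * β w (X w) :=
    funext fun w => (β w).map_smul _ _
  unfold extD
  rw [h3, dirDeriv_mul hf.diffAt h1, bracket_smul_left hf.diffAt hX.diffAt, map_add, map_smul,
    map_smul, dirDeriv_smul_left, smul_eq_mul, smul_eq_mul]
  ring

theorem extD_congr_left {β : OneForm M} (h : X =ᶠ[𝓝 u] Y) : extD β X Z u = extD β Y Z u := by
  have h1 : (fun w => β w (X w)) =ᶠ[𝓝 u] fun w => β w (Y w) := h.mono fun w hw =>
    congrArg (β w) hw
  unfold extD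
  rw [dirDeriv_congr h1, bracket_congr h (EventuallyEq.refl _ Z)]
  unfold dirDeriv
  rw [h.self_of_nhds]

theorem IsFinsler.smoothAt_dJSq (hF : IsFinsler F) (hu : u ∈ slit M) (hX : X.SmoothAt u) :
    FunSmoothAt (fun w => dJSq F w (X w)) u :=
  (hF.smoothAt_energy hu).dirDeriv hX.J

theorem IsFinsler.extD_dJSq_eq_of_eq (hF : IsFinsler F) (hu : u ∈ slit M) (hX : X.SmoothAt u)
    (hY : Y.SmoothAt u) (h : X u = Y u) : extD (dJSq F) X Z u = extD (dJSq F) Y Z u :=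
  eq_of_tensorial (T := fun X => extD (dJSq F) X Z u)
    (fun _ _ h1 h2 => extD_add_left h1 h2 (hF.smoothAt_dJSq hu h1).diffAt
      (hF.smoothAt_dJSq hu h2).diffAt)
    (fun _ _ h1 h2 => extD_smul_left h1 h2 (hF.smoothAt_dJSq hu h2).diffAt)
    (fun _ _ h => extD_congr_left h) hX hY h

/-- Here `α/ρ = d_J F² / 2F²`. Differentiating the factor gives `-dF² ∧ d_J F² / 2F⁴`, and `2
i_𝔽(α/ρ) ∧ (α/ρ)` is its opposite because `i_𝔽 d_J F² = dF²`. -/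
theorem IsIsotropicPair.omega_eq {ρ : TB M → ℝ} {α : OneForm M} (h : IsIsotropicPair S ρ α)
    (hF : IsFinsler F) (hS : IsGeodesicSpray F S) (hflat : NonFlat S) (hu : u ∈ slit M)
    (hX : X.SmoothAt u) (hY : Y.SmoothAt u) :
    omega S ρ α X Y u = (2 * energy F u)⁻¹ * extD (dJSq F) X Y u := by
  have hβ : ∀ w ∈ slit M, (ρ w)⁻¹ • α w = (2 * energy F w)⁻¹ • dJSq F w := by
    intro w hw
    ext ξ
    have h1 := h.form_eq hF hS hw ξ
    have h2 := h.ne_zero hF hS hflat hw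
    have h3 : 2 * energy F w ≠ 0 := (mul_pos two_pos (hF.energy_pos hw)).ne'
    change (ρ w)⁻¹ * α w ξ = (2 * energy F w)⁻¹ * dJSq F w ξ
    rw [inv_mul_eq_div, inv_mul_eq_div, div_eq_div_iff h2 h3]
    linarith
  have hE := hF.smoothAt_energy hu
  have hE0 := hF.energy_pos hu
  have hE2 : 2 * energy F u ≠ 0 := (mul_pos two_pos hE0).ne'
  have hE2' := (FunSmoothAt.const 2).mul hE
  have hd : ∀ Z : VField M, dirDeriv Z (fun w => (2 * energy F w)⁻¹) u =
      - (2 * dirDeriv Z (energy F) u) / (2 * energy F u) ^ 2 := fun Z => by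
    rw [dirDeriv_inv hE2' hE2, dirDeriv_const_mul 2 hE.diffAt]
  have h1 : extD (fun w => (ρ w)⁻¹ • α w) X Y u =
      extD (fun w => (2 * energy F w)⁻¹ • dJSq F w) X Y u :=
    extD_congr ((eventually_mem_slit hu).mono fun w hw => hβ w hw)
  change extD (fun w => (ρ w)⁻¹ • α w) X Y u + 2 * (((ρ u)⁻¹ • α u) (almostComplex S X u) *
    ((ρ u)⁻¹ • α u) (Y u) - ((ρ u)⁻¹ • α u) (almostComplex S Y u) * ((ρ u)⁻¹ • α u) (X u)) = _
  have h2 : ∀ ξ : TTB u, ((2 * energy F u)⁻¹ • dJSq F u) ξ = (2 * energy F u)⁻¹ * dJSq F u ξ :=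
    fun _ => rfl
  rw [h1, hβ u hu, extD_smul (hE2'.inv hE2).diffAt (hF.smoothAt_dJSq hu hX).diffAt
    (hF.smoothAt_dJSq hu hY).diffAt, hd, hd, h2, h2, h2, h2,
    hS.differential_almostComplex hF hu hX, hS.differential_almostComplex hF hu hY]
  field_simp
  ring

theorem IsIsotropicPair.isRegular {ρ : TB M → ℝ} {α : OneForm M} (h : IsIsotropicPair S ρ α)
    (hF : IsFinsler F) (hS : IsGeodesicSpray F S) (hflat : NonFlat S) : IsRegular S ρ α := by
  intro u hu X hX hΩ
  have h0 : ∀ Y : VField M, Y.SmoothAt u → extD (dJSq F) X Y u = 0 := by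
    intro Y hY
    have h1 := hΩ Y hY
    rw [h.omega_eq hF hS hflat hu hX hY] at h1
    exact (mul_eq_zero.1 h1).resolve_left
      (inv_ne_zero (mul_pos two_pos (hF.energy_pos hu)).ne')
  -- Vertical test fields detect the projection of `X`. Once `X` is known to be vertical at `u`, it
  -- may be replaced by some `J Z`, and arbitrary test fields detect the projection of `Z`.
  have h1 : projDeriv u (X u) = 0 := by
    refine hF.nondegenerate u hu _ fun b => ?_
    obtain ⟨ξ, rfl⟩ := projDeriv_surjective u b
    obtain ⟨Y, rfl, hY⟩ := exists_extension ξ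
    have h2 := h0 _ hY.self_of_nhds.J
    rw [extD_swap, hF.extD_J hu hY.self_of_nhds hX] at h2
    rw [hF.metricTensor_symm hu]
    linarith
  obtain ⟨ζ, hζ⟩ := exists_tangentStr (tangentStr_eq_zero_iff.2 h1)
  obtain ⟨Z, rfl, hZ⟩ := exists_extension ζ
  rw [hζ, tangentStr_eq_zero_iff]
  refine hF.nondegenerate u hu _ fun b => ?_
  obtain ⟨ξ, rfl⟩ := projDeriv_surjective u b
  obtain ⟨Y, rfl, hY⟩ := exists_extension ξ
  have h2 := h0 Y hY.self_of_nhds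
  rw [hF.extD_dJSq_eq_of_eq hu hX hZ.self_of_nhds.J hζ,
    hF.extD_J hu hZ.self_of_nhds hY.self_of_nhds] at h2
  linarith

end Regularity

/-! ### Berwald frames -/

section Berwald

variable {F : TB M → ℝ} {H : VField M}

/-- `H` is a smooth horizontal field orthogonal to the geodesic spray `S` of `F`, and of the same
length as `S`. -/
structure IsAdapted (F : TB M → ℝ) (S H : VField M) : Prop where
  finsler : IsFinsler F
  geodesic : IsGeodesicSpray F S
  smooth : H.Smooth
  horizontal : ∀ u ∈ slit M, hProj S H u = H u
  tangent : ∀ u ∈ slit M, dirDeriv (J H) (energy F) u = 0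
  unit : ∀ u ∈ slit M,
    metricTensor F u (projDeriv u (H u)) (projDeriv u (H u)) = energy F u

theorem hProj_eq_of_eventuallyEq (h : Z =ᶠ[𝓝 u] Y) (hY : Y.SmoothAt u) :
    hProj S Z u = horMap S u (Y u) := by
  rw [hProj_congr h, hProj_eq_horMap hY.diffAt]

theorem eventuallyEq_of_forall_slit (hu : u ∈ slit M) (h : ∀ w ∈ slit M, X w = Y w) :
    X =ᶠ[𝓝 u] Y :=
  (eventually_mem_slit hu).mono h

theorem eventually_of_forall_slit (hu : u ∈ slit M) {p : TB M → Prop} (h : ∀ w ∈ slit M, p w) :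
    ∀ᶠ w in 𝓝 u, p w :=
  (eventually_mem_slit hu).mono h

theorem smoothAt_zero (u : TB M) : (0 : VField M).SmoothAt u := by
  have h := (smoothAt_liouville u).const_smul 0
  rwa [zero_smul] at h

theorem IsBerwald.tangent {ρ : TB M → ℝ} {α : OneForm M} (hH : IsBerwald F S α H)
    (h : IsIsotropicPair S ρ α) (hF : IsFinsler F) (hS : IsGeodesicSpray F S) (hflat : NonFlat S)
    (hu : u ∈ slit M) : dirDeriv (J H) (energy F) u = 0 := by
  have h1 := h.form_eq hF hS hu (H u)
  rw [hH.alpha_eq_zero u hu, mul_zero] at h1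
  exact (mul_eq_zero.1 h1.symm).resolve_left (h.ne_zero hF hS hflat hu)

/-- For horizontal `H` the vector `[S, h]H` is vertical, as `J[S, h]H = v H = 0`, so `h` kills it.
-/
theorem IsSpray.almostComplex_of_horizontal (hS : IsSpray S) (hu : u ∈ slit M)
    (hH : H.SmoothAt u) (h : hProj S H u = H u) : almostComplex S H u = - J H u := by
  have h1 : tangentStr u (lieH S H u) = 0 := by
    rw [hS.tangentStr_lieH hu hH, vProj_apply, h, sub_self]
  change hProj S (lieH S H) u - J H u = _
  rw [hProj_eq_horMap ((hS.smoothAt hu).lieH hH).diffAt, hS.horMap_of_vertical hu h1, zero_sub]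

/-- With `𝔽 H = -J H`, the value `G(H, H)` becomes `½ dd_J F²(J H, H)`, which `IsFinsler.extD_J`
evaluates. -/
theorem IsBerwald.unit {α : OneForm M} (hH : IsBerwald F S α H) (hF : IsFinsler F)
    (hS : IsGeodesicSpray F S) (hu : u ∈ slit M) :
    metricTensor F u (projDeriv u (H u)) (projDeriv u (H u)) = energy F u := by
  have hs := hH.smooth u hu
  have h1 : almostComplex S H =ᶠ[𝓝 u] J (-H) :=
    eventuallyEq_of_forall_slit hu fun w hw => by
      rw [hS.1.almostComplex_of_horizontal hw (hH.smooth w hw) (hH.horizontal w hw), J_neg]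
      rfl
  have h2 := hH.normalised u hu
  unfold metricG hilbertForm at h2
  rw [extD_swap, extD_congr_left h1, hF.extD_J hu hs.neg hs] at h2
  have h3 : metricTensor F u (projDeriv u ((-H) u)) (projDeriv u (H u)) =
      - metricTensor F u (projDeriv u (H u)) (projDeriv u (H u)) := by
    change metricTensor F u (projDeriv u (-(H u))) _ = _
    rw [metricTensor_eq, metricTensor_eq, map_neg, map_neg]
    exact mul_neg _ _
  rw [h3] at h2
  unfold energy
  linarith

theorem IsBerwald.isAdapted {ρ : TB M → ℝ} {α : OneForm M} (hH : IsBerwald F S α H)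
    (h : IsIsotropicPair S ρ α) (hF : IsFinsler F) (hS : IsGeodesicSpray F S) (hflat : NonFlat S) :
    IsAdapted F S H where
  finsler := hF
  geodesic := hS
  smooth := hH.smooth
  horizontal := hH.horizontal
  tangent _ hu := hH.tangent h hF hS hflat hu
  unit _ hu := hH.unit hF hS hu

/-- `dd_J F² (J X, Y) = J [Y, J X] (F²)` when `J X` and `J Y` are tangent to the indicatrix. -/
theorem IsFinsler.J_bracket_energy (hF : IsFinsler F) (hu : u ∈ slit M)
    (hX : X.SmoothAt u) (hY : Y.SmoothAt u)
    (h : dirDeriv (J X) (dirDeriv (J Y) (energy F)) u = 0) :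
    dirDeriv (J (bracket Y (J X))) (energy F) u =
      2 * metricTensor F u (projDeriv u (X u)) (projDeriv u (Y u)) := by
  have h1 := hF.extD_J hu hX hY
  have h2 : dirDeriv Y (dirDeriv (0 : VField M) (energy F)) u = 0 :=
    dirDeriv_eq_zero_of_eventually
      (Eventually.of_forall fun w => (differential (energy F) w).map_zero)
  have h3 : dirDeriv (J (bracket (J X) Y)) (energy F) u =
      - dirDeriv (J (bracket Y (J X))) (energy F) u := by
    change differential _ u (tangentStr u (bracket (J X) Y u)) =
      - differential _ u (tangentStr u (bracket Y (J X) u))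
    rw [bracket_swap, map_neg, map_neg]
  rw [extD_dJSq, J_J, h2, h, h3] at h1
  linarith

theorem IsSpray.projDeriv_self (hS : IsSpray S) (hu : u ∈ slit M) : projDeriv u (S u) = vec u :=
  verticalLift_injective u (hS.tangentStr_self hu)

theorem apply_smul_smul_smul (T : Plane →L[ℝ] Plane →L[ℝ] Plane →L[ℝ] ℝ)
    (c : ℝ) (a : Plane) : T (c • a) (c • a) (c • a) = c ^ 3 * T a a a := by
  rw [T.map_smul, _root_.smul_apply, _root_.smul_apply, (T a).map_smul, _root_.smul_apply,
    (T a a).map_smul, smul_eq_mul, smul_eq_mul, smul_eq_mul]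
  ring

/-- The coefficient of `H` in `[H, J H]`. -/
noncomputable def bracketCoeff (F : TB M → ℝ) (H : VField M) (u : TB M) : ℝ :=
  -(dirDeriv (J (bracket (J H) (bracket H (J H)))) (energy F) u / (2 * energy F u))

/-! ### Brackets of the adapted frame with the spray -/

namespace IsAdapted

theorem spray (hH : IsAdapted F S H) : IsSpray S := hH.geodesic.1

theorem smoothAt_spray (hH : IsAdapted F S H) (hu : u ∈ slit M) : S.SmoothAt u :=
  hH.spray.smoothAt hu

theorem smoothAt_bracket_spray (hH : IsAdapted F S H) (hu : u ∈ slit M) :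
    (bracket S H).SmoothAt u :=
  (hH.smoothAt_spray hu).bracket (hH.smooth u hu)

theorem smoothAt_bracket (hH : IsAdapted F S H) (hu : u ∈ slit M) :
    (bracket H (J H)).SmoothAt u :=
  (hH.smooth u hu).bracket (hH.smooth u hu).J

theorem horMap_eq (hH : IsAdapted F S H) (hu : u ∈ slit M) : horMap S u (H u) = H u := by
  rw [← hProj_eq_horMap (hH.smooth u hu).diffAt, hH.horizontal u hu]

theorem dirDeriv_energy (hH : IsAdapted F S H) (hu : u ∈ slit M) :
    dirDeriv H (energy F) u = 0 := by
  change differential _ u (H u) = 0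
  rw [← hH.horMap_eq hu]
  exact hH.geodesic.differential_horMap hH.finsler hu _

theorem J_ne_zero (hH : IsAdapted F S H) (hu : u ∈ slit M) : tangentStr u (H u) ≠ 0 := by
  intro h
  have h1 := hH.unit u hu
  rw [tangentStr_eq_zero_iff.1 h, metricTensor_eq, map_zero, mul_zero] at h1
  exact (hH.finsler.energy_pos hu).ne h1

theorem J_bracket_energy (hH : IsAdapted F S H) (hu : u ∈ slit M) :
    dirDeriv (J (bracket H (J H))) (energy F) u = 2 * energy F u := by
  rw [hH.finsler.J_bracket_energy hu (hH.smooth u hu) (hH.smooth u hu)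
    (dirDeriv_eq_zero_of_eventually (eventually_of_forall_slit hu hH.tangent)), hH.unit u hu]

theorem J_bracket_spray_energy (hH : IsAdapted F S H) (hu : u ∈ slit M) :
    dirDeriv (J (bracket S H)) (energy F) u = 0 := by
  have h := hH.geodesic.euler_lagrange hH.finsler hu (hH.smooth u hu)
  rw [hH.dirDeriv_energy hu,
    dirDeriv_eq_zero_of_eventually (eventually_of_forall_slit hu hH.tangent)] at h
  linarith

/-- Euler–Lagrange for `[H, J H]`: this field annihilates the energy because `H` and `J H` do, and
`J[H, J H](F²) = 2F²` is constant along `S`. -/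
theorem J_bracket_bracket_energy (hH : IsAdapted F S H) (hu : u ∈ slit M) :
    dirDeriv (J (bracket S (bracket H (J H)))) (energy F) u = 0 := by
  have hE := hH.finsler.smoothAt_energy hu
  have hs := hH.smooth u hu
  have h := hH.geodesic.euler_lagrange hH.finsler hu (hH.smoothAt_bracket hu)
  rw [dirDeriv_bracket hs hs.J hE,
    dirDeriv_eq_zero_of_eventually (eventually_of_forall_slit hu hH.tangent),
    dirDeriv_eq_zero_of_eventually
      (eventually_of_forall_slit hu fun w hw => hH.dirDeriv_energy hw),
    dirDeriv_congr (g := fun w => 2 * energy F w)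
      (eventually_of_forall_slit hu fun w hw => hH.J_bracket_energy hw),
    dirDeriv_const_mul 2 hE.diffAt, hH.geodesic.dirDeriv_self hu] at h
  linarith

/-- A rewriting of `Γ H = H`, which is the horizontality of `H`. -/
theorem bracket_spray_J (hH : IsAdapted F S H) (hu : u ∈ slit M) :
    bracket S (J H) u = (J (bracket S H) - H) u := by
  have h := hH.horizontal u hu
  rw [hProj_apply, connection_apply, bracket_swap (X := J H), bracket_swap (X := H), map_neg] at h
  change _ = tangentStr u (bracket S H u) - H u
  have h1 := congrArg (fun ξ => (2 : ℝ) • ξ) h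
  simp only [smul_smul] at h1
  norm_num at h1
  rw [two_smul] at h1
  have h2 := add_left_cancel h1
  rw [← h2]
  abel

theorem bracket_spray_bracket (hH : IsAdapted F S H) (hu : u ∈ slit M) :
    bracket S (bracket H (J H)) u =
      bracket (bracket S H) (J H) u + bracket H (bracket S (J H)) u :=
  leibniz_bracket (hH.smoothAt_spray hu) (hH.smooth u hu) (hH.smooth u hu).J

/-- The field `[S, H]` is vertical. -/
theorem J_bracket_spray (hH : IsAdapted F S H) (hu : u ∈ slit M) :
    tangentStr u (bracket S H u) = 0 := by
  have hF := hH.finsler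
  have hs := hH.smooth u hu
  have hP := hH.smoothAt_bracket_spray hu
  -- With `P = [S, H]`, the Jacobi identity reads `[S, [H, J H]] = [P, J H] + [H, J P]`. Applying
  -- `J` and then `dF²` gives `0 = 4 g(H, P)`. As `J P = b J H`, this is `4 b F²`, whence `b = 0`.
  have h1 : bracket H (bracket S (J H)) u = bracket H (J (bracket S H)) u := by
    rw [bracket_congr (EventuallyEq.refl _ H)
      (eventuallyEq_of_forall_slit hu fun w hw => hH.bracket_spray_J hw),
      bracket_sub_right hP.J.diffAt hs.diffAt, bracket_self, sub_zero]
  have h2 := hF.J_bracket_energy hu hs hP (dirDeriv_eq_zero_of_eventually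
    (eventually_of_forall_slit hu fun w hw => hH.J_bracket_spray_energy hw))
  have h3 := hF.J_bracket_energy hu hP hs (dirDeriv_eq_zero_of_eventually
    (eventually_of_forall_slit hu hH.tangent))
  have h4 := hH.J_bracket_bracket_energy hu
  change differential _ u (tangentStr u (bracket S (bracket H (J H)) u)) = 0 at h4
  rw [hH.bracket_spray_bracket hu, h1, map_add, map_add] at h4
  change dirDeriv (J (bracket (bracket S H) (J H))) (energy F) u +
    dirDeriv (J (bracket H (J (bracket S H)))) (energy F) u = 0 at h4
  rw [h2, h3, hF.metricTensor_symm hu (projDeriv u (bracket S H u))] at h4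
  obtain ⟨b, hb⟩ := hF.exists_eq_smul hu (tangentStr_tangentStr (H u))
    (tangentStr_tangentStr (bracket S H u)) (hH.J_ne_zero hu) (hH.tangent u hu)
    (hH.J_bracket_spray_energy hu)
  have h5 : projDeriv u (bracket S H u) = b • projDeriv u (H u) := by
    apply verticalLift_injective u
    rw [map_smul]
    exact hb
  have h6 := hH.unit u hu
  rw [metricTensor_eq] at h6
  rw [h5, metricTensor_eq, map_smul, smul_eq_mul] at h4
  have h7 : b * energy F u = 0 := by
    rw [← h6]
    linarith
  rw [hb, (mul_eq_zero.1 h7).resolve_right (hF.energy_pos hu).ne', zero_smul]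

theorem bracket_spray_J_eq (hH : IsAdapted F S H) (hu : u ∈ slit M) :
    bracket S (J H) u = (-H) u := by
  rw [hH.bracket_spray_J hu]
  change tangentStr u (bracket S H u) - H u = - H u
  rw [hH.J_bracket_spray hu, zero_sub]

theorem bracket_spray_eq_jacobi (hH : IsAdapted F S H) (hu : u ∈ slit M) :
    bracket S H u = jacobi S H u := by
  rw [hH.spray.jacobi_eq hu (hH.smooth u hu), bracket_congr (EventuallyEq.refl _ S)
    (eventuallyEq_of_forall_slit hu hH.horizontal),
    hH.spray.horMap_of_vertical hu (hH.J_bracket_spray hu), sub_zero]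

theorem dynCov_eq_zero (hH : IsAdapted F S H) (hu : u ∈ slit M) : dynCov S H u = 0 := by
  have h1 : bracket S (hProj S H) =ᶠ[𝓝 u] bracket S H :=
    bracket_eventuallyEq (EventuallyEq.refl _ S) (eventuallyEq_of_forall_slit hu hH.horizontal)
  have h2 : vProj S H =ᶠ[𝓝 u] 0 := eventuallyEq_of_forall_slit hu fun w hw => by
    rw [vProj_apply, hH.horizontal w hw, sub_self]
    rfl
  have h3 : bracket S (vProj S H) =ᶠ[𝓝 u] 0 :=
    (bracket_eventuallyEq (EventuallyEq.refl _ S) h2).trans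
      (Eventually.of_forall fun w => bracket_zero_right S w)
  change hProj S (bracket S (hProj S H)) u + vProj S (bracket S (vProj S H)) u = 0
  rw [hProj_eq_of_eventuallyEq h1 (hH.smoothAt_bracket_spray hu),
    hH.spray.horMap_of_vertical hu (hH.J_bracket_spray hu), vProj_apply,
    hProj_eq_of_eventuallyEq h3 (smoothAt_zero u), h3.self_of_nhds]
  change (0 : TTB u) + (0 - horMap S u 0) = 0
  rw [map_zero, sub_zero, add_zero]

theorem dynCov_J_eq_zero (hH : IsAdapted F S H) (hu : u ∈ slit M) : dynCov S (J H) u = 0 := by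
  have hs := hH.smooth u hu
  have h0 : hProj S (J H) =ᶠ[𝓝 u] 0 := eventuallyEq_of_forall_slit hu fun w hw => by
    rw [hProj_eq_horMap (hH.smooth w hw).J.diffAt]
    exact hH.spray.horMap_tangentStr hw _
  have h1 : bracket S (hProj S (J H)) =ᶠ[𝓝 u] 0 :=
    (bracket_eventuallyEq (EventuallyEq.refl _ S) h0).trans
      (Eventually.of_forall fun w => bracket_zero_right S w)
  have h2 : vProj S (J H) =ᶠ[𝓝 u] J H := h0.mono fun w hw => by
    rw [vProj_apply, hw]
    exact sub_zero _
  have h3 : bracket S (vProj S (J H)) =ᶠ[𝓝 u] -H :=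
    (bracket_eventuallyEq (EventuallyEq.refl _ S) h2).trans
      (eventuallyEq_of_forall_slit hu fun w hw => hH.bracket_spray_J_eq hw)
  change hProj S (bracket S (hProj S (J H))) u + vProj S (bracket S (vProj S (J H))) u = 0
  rw [hProj_eq_of_eventuallyEq h1 (smoothAt_zero u), vProj_apply,
    hProj_eq_of_eventuallyEq h3 hs.neg, h3.self_of_nhds]
  change horMap S u 0 + (- H u - horMap S u (- H u)) = 0
  rw [map_zero, map_neg, hH.horMap_eq hu, sub_self, add_zero]

/-! ### The bracket `[H, J H]` and the main scalar -/

theorem smoothAt_bracketCoeff (hH : IsAdapted F S H) (hu : u ∈ slit M) :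
    FunSmoothAt (bracketCoeff F H) u := by
  have hE := hH.finsler.smoothAt_energy hu
  have hs := hH.smooth u hu
  exact ((hE.dirDeriv (hs.J.bracket (hH.smoothAt_bracket hu)).J).div
    ((FunSmoothAt.const 2).mul hE) (mul_pos two_pos (hH.finsler.energy_pos hu)).ne').neg

/-- This explains the formula for `bracketCoeff`. Evaluate `dd_J F²(J H, [H, J H])` through
`IsFinsler.J_bracket_energy`, whose hypothesis holds since `J[H, J H](F²) = 2F²` and `J H` kills
`F²`. -/
theorem metricTensor_bracket (hH : IsAdapted F S H) (hu : u ∈ slit M) :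
    metricTensor F u (projDeriv u (H u)) (projDeriv u (bracket H (J H) u)) =
      bracketCoeff F H u * energy F u := by
  have hs := hH.smooth u hu
  have hQ := hH.smoothAt_bracket hu
  have hE := hH.finsler.smoothAt_energy hu
  have h0 := hH.finsler.energy_pos hu
  have h1 : dirDeriv (J H) (dirDeriv (J (bracket H (J H))) (energy F)) u = 0 := by
    rw [dirDeriv_congr (g := fun w => 2 * energy F w)
      (eventually_of_forall_slit hu fun w hw => hH.J_bracket_energy hw),
      dirDeriv_const_mul 2 hE.diffAt, hH.tangent u hu, mul_zero]
  have h2 := hH.finsler.J_bracket_energy hu hs hQ h1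
  have h3 : dirDeriv (J (bracket (bracket H (J H)) (J H))) (energy F) u =
      - dirDeriv (J (bracket (J H) (bracket H (J H)))) (energy F) u := by
    change differential _ u (tangentStr u (bracket (bracket H (J H)) (J H) u)) =
      - differential _ u (tangentStr u (bracket (J H) (bracket H (J H)) u))
    rw [bracket_swap, map_neg, map_neg]
  rw [h3] at h2
  unfold bracketCoeff
  field_simp
  linarith

/-- The geodesic equation tested on `J H`, with `S` projecting to `y`. -/
theorem metricTensor_vec (hH : IsAdapted F S H) (hu : u ∈ slit M) :
    metricTensor F u (projDeriv u (H u)) (vec u) = 0 := by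
  have hs := hH.smooth u hu
  have h1 := hH.finsler.extD_J hu hs (hH.smoothAt_spray hu)
  rw [extD_swap, hH.geodesic.2 u hu _ hs.J, hH.spray.projDeriv_self hu] at h1
  have h2 := hH.tangent u hu
  change dirDeriv (J H) (fun w => F w ^ 2) u = 0 at h2
  rw [h2] at h1
  linarith

/-- Both `J[H, J H]` and `C` have energy derivative `2F²`, so they differ by a multiple of `J H`.
Pairing with `H`, which is orthogonal to `y`, identifies the multiple. -/
theorem projDeriv_bracket (hH : IsAdapted F S H) (hu : u ∈ slit M) :
    projDeriv u (bracket H (J H) u) = vec u + bracketCoeff F H u • projDeriv u (H u) := by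
  have hF := hH.finsler
  have h0 := hF.energy_pos hu
  have h1 : tangentStr u (tangentStr u (bracket H (J H) u) - liouville M u) = 0 := by
    rw [map_sub, tangentStr_tangentStr, tangentStr_liouville, sub_zero]
  have h2 : differential (energy F) u (tangentStr u (bracket H (J H) u) - liouville M u) = 0 := by
    rw [map_sub]
    exact sub_eq_zero.2 ((hH.J_bracket_energy hu).trans (hF.dirDeriv_liouville hu).symm)
  obtain ⟨b, hb⟩ := hF.exists_eq_smul hu (tangentStr_tangentStr (H u)) h1 (hH.J_ne_zero hu)
    (hH.tangent u hu) h2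
  have h3 : projDeriv u (bracket H (J H) u) = vec u + b • projDeriv u (H u) := by
    apply verticalLift_injective u
    rw [map_add, map_smul]
    exact sub_eq_iff_eq_add'.1 hb
  have h4 := hH.metricTensor_bracket hu
  have h5 := hH.metricTensor_vec hu
  have h6 := hH.unit u hu
  rw [metricTensor_eq] at h4 h5 h6
  rw [h3, map_add, map_smul, smul_eq_mul] at h4
  have h7 : b * energy F u = bracketCoeff F H u * energy F u := by
    rw [← h4, ← h6]
    linarith
  rw [h3, mul_right_cancel₀ h0.ne' h7]

/-- By the Jacobi identity the inner bracket is `[ρ V, V] + [H, -H] = -V(ρ) V`, where `V = J H`. -/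
theorem bracket_bracket_spray_vertical (hH : IsAdapted F S H) {ρ : TB M → ℝ} (hρ : FunSmooth ρ)
    (h : ∀ u ∈ slit M, bracket S H u = ρ u • J H u) (hu : u ∈ slit M) :
    J (bracket S (bracket H (J H))) u = 0 := by
  have hs := hH.smooth u hu
  change tangentStr u (bracket S (bracket H (J H)) u) = 0
  rw [hH.bracket_spray_bracket hu,
    bracket_congr (X' := ρ • J H) (eventuallyEq_of_forall_slit hu h) (EventuallyEq.refl _ (J H)),
    bracket_congr (EventuallyEq.refl _ H)
      (eventuallyEq_of_forall_slit hu fun w hw => hH.bracket_spray_J_eq hw),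
    bracket_smul_left (hρ u hu).diffAt hs.J.diffAt, bracket_neg_right hs.diffAt, bracket_self,
    bracket_self, neg_zero, smul_zero, add_zero, add_zero, map_smul]
  exact (congrArg _ (tangentStr_tangentStr (H u))).trans (smul_zero _)

/-- Let `b` be `bracketCoeff F H`. The remainder `W = [H, J H] - S - b H` is vertical, so `W = -J[S,
W]`. In `[S, W]` every term except `-S(b) H` is vertical. -/
theorem bracket_eq (hH : IsAdapted F S H) {ρ : TB M → ℝ} (hρ : FunSmooth ρ)
    (h : ∀ u ∈ slit M, bracket S H u = ρ u • J H u) (hu : u ∈ slit M) :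
    bracket H (J H) u = S u + bracketCoeff F H u • H u +
      dirDeriv S (bracketCoeff F H) u • J H u := by
  have hs := hH.smooth u hu
  have hQ := hH.smoothAt_bracket hu
  have hS := hH.smoothAt_spray hu
  have hb := hH.smoothAt_bracketCoeff hu
  have hbH : (bracketCoeff F H • H).SmoothAt u := hs.smul hb
  let W : VField M := bracket H (J H) - S - bracketCoeff F H • H
  have hW : W.SmoothAt u := (hQ.sub hS).sub hbH
  have hv : ∀ᶠ w in 𝓝 u, J W w = 0 := eventually_of_forall_slit hu fun w hw => by
    rw [show J W w = tangentStr w (W w) from rfl, tangentStr_eq_zero_iff]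
    change projDeriv w (bracket H (J H) w - S w - bracketCoeff F H w • H w) = 0
    rw [map_sub, map_sub, map_smul, hH.projDeriv_bracket hw, hH.spray.projDeriv_self hw,
      add_sub_cancel_left, sub_self]
  have h1 := hH.spray.J_bracket hu hW hv
  have h2 : bracket S W u = bracket S (bracket H (J H)) u -
      (dirDeriv S (bracketCoeff F H) u • H u + bracketCoeff F H u • bracket S H u) := by
    change bracket S (bracket H (J H) - S - bracketCoeff F H • H) u = _
    rw [bracket_sub_right (hQ.sub hS).diffAt hbH.diffAt, bracket_sub_right hQ.diffAt hS.diffAt,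
      bracket_self, sub_zero, bracket_smul_right hb.diffAt hs.diffAt]
  have h3 : tangentStr u (bracket S (bracket H (J H)) u) = 0 :=
    hH.bracket_bracket_spray_vertical hρ h hu
  change tangentStr u (bracket S W u) = _ at h1
  rw [h2, map_sub, h3, map_add, map_smul, map_smul, hH.J_bracket_spray hu, smul_zero, add_zero,
    zero_sub] at h1
  have h4 : bracket H (J H) u - S u - bracketCoeff F H u • H u =
      dirDeriv S (bracketCoeff F H) u • J H u := (neg_injective h1).symm
  rw [← h4]
  abel

/-- The main scalar is the coefficient of `H` in `[H, J H]`. -/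
theorem mainScalar_eq (hH : IsAdapted F S H) (hu : u ∈ slit M) :
    mainScalar F H u = bracketCoeff F H u := by
  have hF := hH.finsler
  have hs := hH.smooth u hu
  have h0 := hF.energy_pos hu
  set η := fibreProj H u.1 with hη
  set y := vec u with hy
  set e := fibreSq F u.1 with he
  have hηy : η y = projDeriv u (H u) := rfl
  have d1 : HasFDerivAt η (fderiv ℝ η y) y := (differentiableAt_fibreProj hs).hasFDerivAt
  have d2 : HasFDerivAt (fderiv ℝ (fderiv ℝ e)) (fderiv ℝ (fderiv ℝ (fderiv ℝ e)) y) y :=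
    ((((hF.contDiffAt_fibreSq hu).fderiv_right (m := ∞) (by simp)).fderiv_right (m := ∞)
      (by simp)).differentiableAt (by simp)).hasFDerivAt
  have d3 := (d2.clm_apply d1).clm_apply d1
  have d4 : HasFDerivAt e (fderiv ℝ e y) y :=
    ((hF.contDiffAt_fibreSq hu).differentiableAt (by simp)).hasFDerivAt
  -- The normalisation `g(H, H) = F²` along the fibre. Its derivative at `y` in the direction `η y`
  -- expresses the third derivative of `e` through `Dη(η)`.
  have d5 : (fun a => fderiv ℝ (fderiv ℝ e) a (η a) (η a)) =ᶠ[𝓝 y] fun a => (2 : ℝ) • e a := by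
    filter_upwards [eventually_toTB_mem_slit hu] with a ha
    have h1 := hH.unit _ ha
    rw [metricTensor_eq] at h1
    change 1 / 2 * fderiv ℝ (fderiv ℝ e) a (η a) (η a) = e a at h1
    rw [smul_eq_mul]
    linarith
  have h1 := congrArg (fun l => l (η y))
    ((d3.congr_of_eventuallyEq d5.symm).unique (d4.const_smul (2 : ℝ)))
  have h2 : fderiv ℝ e y (η y) = 0 :=
    (hF.differential_tangentStr hu _).symm.trans (hH.tangent u hu)
  -- The fibre derivative of `η` along itself is the projection of `[J H, H]`, which is already
  -- known.
  have h3 : fderiv ℝ η y (η y) = -(y + bracketCoeff F H u • η y) :=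
    (fderiv_fibreProj hs hs).trans (by rw [bracket_swap, map_neg, hH.projDeriv_bracket hu]; rfl)
  have h4 := hH.metricTensor_vec hu
  have h5 := (hF.metricTensor_symm hu (vec u) (projDeriv u (H u))).trans h4
  have h6 := hH.unit u hu
  rw [metricTensor_eq] at h4 h5 h6
  -- The `y` part of `Dη(η)` drops out by orthogonality, leaving `4 b F²` with `b = bracketCoeff F H
  -- u`. The factors `F`, `1/4` and `F⁻³` in the main scalar then reduce this to `b`.
  have h7 : fderiv ℝ (fderiv ℝ (fderiv ℝ e)) y (η y) (η y) (η y) =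
      4 * bracketCoeff F H u * energy F u := by
    simp only [_root_.add_apply, ContinuousLinearMap.comp_apply,
      ContinuousLinearMap.flip_apply, _root_.smul_apply, h2, h3, map_neg, map_add,
      map_smul, _root_.neg_apply, smul_eq_mul] at h1
    rw [← hηy] at h4 h5 h6
    linear_combination h1 + 2 * h4 + 2 * h5 + 4 * bracketCoeff F H u * h6
  have hF0 := hF.pos u hu
  change F u * (1 / 4 * iteratedFDeriv ℝ 3 e y ![(F u)⁻¹ • η y, (F u)⁻¹ • η y, (F u)⁻¹ • η y]) = _
  rw [iteratedFDeriv_succ_apply_right, iteratedFDeriv_two_apply]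
  change F u * (1 / 4 * fderiv ℝ (fderiv ℝ (fderiv ℝ e)) y ((F u)⁻¹ • η y) ((F u)⁻¹ • η y)
    ((F u)⁻¹ • η y)) = _
  rw [apply_smul_smul_smul, h7]
  unfold energy
  field_simp

end IsAdapted

/-- The structure equations of the Berwald frame. -/
theorem IsBerwald.structure_equations {ρ : TB M → ℝ} {α : OneForm M} (hH : IsBerwald F S α H)
    (h : IsIsotropicPair S ρ α) (hF : IsFinsler F) (hS : IsGeodesicSpray F S) (hflat : NonFlat S)
    (hu : u ∈ slit M) :
    bracket S H u = ρ u • J H u ∧ bracket S (J H) u = - H u ∧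
      bracket H (J H) u =
        S u + mainScalar F H u • H u + dirDeriv S (mainScalar F H) u • J H u := by
  have hA := hH.isAdapted h hF hS hflat
  have h1 : ∀ w ∈ slit M, bracket S H w = ρ w • J H w := fun w hw => by
    rw [hA.bracket_spray_eq_jacobi hw, h.eq w hw H (hH.smooth w hw), hH.alpha_eq_zero w hw,
      zero_smul, sub_zero]
  refine ⟨h1 u hu, hA.bracket_spray_J_eq hu, ?_⟩
  rw [hA.mainScalar_eq hu, dirDeriv_congr (g := bracketCoeff F H)
    (eventually_of_forall_slit hu fun w hw => hA.mainScalar_eq hw)]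
  exact hA.bracket_eq h.smooth_ρ h1 hu

theorem IsAdapted.smooth_mainScalar (hH : IsAdapted F S H) : FunSmooth (mainScalar F H) :=
  fun _ hu => (hH.smoothAt_bracketCoeff hu).congr
    (eventually_of_forall_slit hu fun _ hw => hH.mainScalar_eq hw)

end Berwald

end Calculus

end BerwaldFrame

theorem mainTheorem4 {M : Type*} [TopologicalSpace M] [ChartedSpace BerwaldFrame.Plane M]
    [IsManifold 𝓘(ℝ, BerwaldFrame.Plane) ∞ M]
    (F : BerwaldFrame.TB M → ℝ) (S : BerwaldFrame.VField M)
    (hF : BerwaldFrame.IsFinsler F) (hS : BerwaldFrame.IsGeodesicSpray F S)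
    (hflat : BerwaldFrame.NonFlat S) :
    (∃ (ρ : BerwaldFrame.TB M → ℝ) (α : BerwaldFrame.OneForm M),
      BerwaldFrame.IsIsotropicPair S ρ α) ∧
    ∀ (ρ : BerwaldFrame.TB M → ℝ) (α : BerwaldFrame.OneForm M),
      BerwaldFrame.IsIsotropicPair S ρ α →
      (∀ u ∈ BerwaldFrame.slit M, ρ u ≠ 0) ∧
      BerwaldFrame.IsRegular S ρ α ∧
      ∀ H : BerwaldFrame.VField M, BerwaldFrame.IsBerwald F S α H →
        BerwaldFrame.FunSmooth (BerwaldFrame.mainScalar F H) ∧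
        ∀ u ∈ BerwaldFrame.slit M,
          BerwaldFrame.dirDeriv H (fun w => F w ^ 2) u = 0 ∧
          BerwaldFrame.dirDeriv (BerwaldFrame.J H) (fun w => F w ^ 2) u = 0 ∧
          BerwaldFrame.dynCov S H u = 0 ∧
          BerwaldFrame.dynCov S (BerwaldFrame.J H) u = 0 ∧
          BerwaldFrame.bracket S H u = ρ u • BerwaldFrame.J H u ∧
          BerwaldFrame.bracket S (BerwaldFrame.J H) u = - H u ∧
          BerwaldFrame.bracket H (BerwaldFrame.J H) u =
            S u + BerwaldFrame.mainScalar F H u • H u +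
              BerwaldFrame.dirDeriv S (BerwaldFrame.mainScalar F H) u • BerwaldFrame.J H u := by
  refine ⟨hS.exists_isIsotropicPair hF, fun ρ α h => ⟨fun u hu => h.ne_zero hF hS hflat hu,
    h.isRegular hF hS hflat, fun H hH => ?_⟩⟩
  have hA := hH.isAdapted h hF hS hflat
  exact ⟨hA.smooth_mainScalar, fun u hu => ⟨hA.dirDeriv_energy hu, hA.tangent u hu,
    hA.dynCov_eq_zero hu, hA.dynCov_J_eq_zero hu, hH.structure_equations h hF hS hflat hu⟩⟩
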